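/- Let $A$ be a finite alphabet. A \emph{class} is a set of languages over $A$. Let $\mathcal C$ be a class of languages that is a Boolean algebra (it contains $\emptyset$ and is closed under union, intersection and complement), is closed under the quotients $w^{-1}L=\{u \mid wu\in L\}$ and $Lw^{-1}=\{u\mid uw\in L\}$ for $L \in \mathcal C$, $w\in A^*$, and consists of group languages (languages $\alpha^{-1}(F)$ with $\alpha:A^*\to G$ a morphism into a finite group and $F\subseteq G$). Let $\mathrm{SF}(\mathcal C)$ be its star-free closure: the least class containing $\mathcal C$ and all $\{a\}$, $a\in A$, and closed under Boolean operations and concatenation. A \emph{rating map} is a morphism $\tau:(2^{A^*},\cup)\to(Q,+)$ of monoids, where $(Q,+)$ is a finite commutative idempotent monoid, ordered by $r\le s \iff r+s=s$; write $\tau(w)$ for $\tau(\{w\})$. It is \emph{nice} if for every nonempty $K\subseteq A^*$ the value $\tau(K)$ is a finite sum of values $\tau(w)$ with $w\in K$, and \emph{multiplicative} if $Q$ is an idempotent semiring, $\tau(\varepsilon)=1_Q$ and $\tau(KL)=\tau(K)\tau(L)$ for all $K,L\subseteq A^*$. For a Boolean algebra $\mathcal D$ of languages, a \emph{$\mathcal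 D$-cover} of $L$ is a finite set $\mathbf K\subseteq\mathcal D$ with $L\subseteq\bigcup_{K\in\mathbf K}K$; its $\tau$-imprint is $\{r\in Q\mid r\le\tau(K)\text{ for some }K\in\mathbf K\}$. A $\mathcal D$-cover of $L$ is \emph{optimal} for $\tau$ if its $\tau$-imprint is contained in that of every $\mathcal D$-cover of $L$. Optimal $\mathcal D$-covers exist; their common $\tau$-imprint is denoted $\mathcal I_{\mathcal D}[L,\tau]\subseteq Q$. A \emph{$\mathcal C$-optimal $\varepsilon$-approximation} for $\tau$ is a language $L\in\mathcal C$ with $\varepsilon\in L$ such that $\tau(L)\le\tau(L')$ for every $L'\in\mathcal C$ with $\varepsilon\in L'$. Such languages exist; their common value $\tau(L)$ is denoted $\iota_{\mathcal C}[\tau]\in Q$. Let $\rho:2^{A^*}\to R$ be a nice multiplicative rating map. Let $\xi:2^{A^*}\to 2^R$ be the rating map $\xi(K)=\mathcal I_{\mathrm{SF}(\mathcal C)}[K,\rho]$, whose rating set is $(2^R,\cup)$. For $S\subseteq R$, let $\eta_{\rho,S}:2^{A^*}\to 2^R$ be the nice multiplicative rating map with $\eta_{\rho,S}(a)=S\cdot\{\rho(a)\}\cdot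 S$ for $a\in A$, where $2^R$ carries union as addition and the elementwise product as multiplication. Fix $\omega\ge1$ such that $r^\omega$ is idempotent for the multiplication for every $r\in R$. Call $S\subseteq R$ \emph{$\mathrm{SF}(\mathcal C)$-complete} for $\rho$ if: \begin{enumerate} \item for all $r\in S$ and $q\in R$ with $q\le r$, $q\in S$; \item for all $q,r\in S$, $qr\in S$; \item $\iota_{\mathcal C}[\eta_{\rho,S}]\subseteq S$; \item for all $r\in S$, $r^\omega+r^{\omega+1}\in S$. \end{enumerate} \textbf{Theorem.} The set $\iota_{\mathcal C}[\xi]$ is the least $\mathrm{SF}(\mathcal C)$-complete subset of $R$ for $\rho$ with respect to inclusion: it is $\mathrm{SF}(\mathcal C)$-complete, and it is contained in every $\mathrm{SF}(\mathcal C)$-complete subset of $R$. -/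

import Mathlib

open scoped Pointwise

namespace StarFreeClosure

universe u v

/-! ## Classes of languages

A word over `A` is a list of letters and a language is a `Language A`, that is, a set of words.
A class of languages that is a Boolean algebra is a `BooleanSubalgebra (Language A)`. -/

section Classes

variable {A : Type u}

/-- The right quotient `Lw⁻¹ = {u | uw ∈ L}`. -/
def rightQuotient (L : Language A) (w : List A) : Language A :=
  {u | u ++ w ∈ L}

/-- Closure under the quotients `w⁻¹L = {u | wu ∈ L}` and `Lw⁻¹ = {u | uw ∈ L}`. -/
def QuotientClosed (C : Set (Language A)) : Prop :=
  ∀ L ∈ C, ∀ w : List A, L.leftQuotient w ∈ C ∧ rightQuotient L w ∈ C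

/-- A group language: one that is recognized by a morphism into a finite group. -/
def IsGroupLanguage (L : Language A) : Prop :=
  ∃ (G : Type) (_ : Group G) (_ : Finite G) (α : FreeMonoid A →* G) (F : Set G),
    ∀ w : List A, w ∈ L ↔ α (FreeMonoid.ofList w) ∈ F

/-- Membership in the star-free closure of `C`: the least class that contains `C` and the languages
`{a}` for letters `a`, and is closed under Boolean operations and concatenation. -/
inductive InStarFree (C : Set (Language A)) : Language A → Prop
  | base {L : Language A} : L ∈ C → InStarFree C L
  | letter (a : A) : InStarFree C {[a]}
  | union {K L : Language A} : InStarFree C K → InStarFree C L → InStarFree C (K ⊔ L)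
  | inter {K L : Language A} : InStarFree C K → InStarFree C L → InStarFree C (K ⊓ L)
  | compl {L : Language A} : InStarFree C L → InStarFree C Lᶜ
  | concat {K L : Language A} : InStarFree C K → InStarFree C L → InStarFree C (K * L)

/-- The star-free closure `SF(C)` of a Boolean algebra `C` of languages. -/
def starFreeClosure (C : BooleanSubalgebra (Language A)) : BooleanSubalgebra (Language A) where
  carrier := {L | InStarFree (C : Set (Language A)) L}
  supClosed' := fun _ hK _ hL => InStarFree.union hK hL
  infClosed' := fun _ hK _ hL => InStarFree.inter hK hL
  compl_mem' := fun hL => InStarFree.compl hL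
  bot_mem' := InStarFree.base C.bot_mem

/-- `𝒦` is a `C`-cover of `L`: a finite set of languages in `C` whose union contains `L`. -/
def IsCover (C : BooleanSubalgebra (Language A)) (L : Language A)
    (𝒦 : Finset (Language A)) : Prop :=
  (∀ K ∈ 𝒦, K ∈ C) ∧ ∀ w ∈ L, ∃ K ∈ 𝒦, w ∈ K

end Classes

/-! ## Rating maps -/

section RatingMaps

variable {A : Type u} {Q : Type v} [SemilatticeSup Q] [OrderBot Q]

/-- Rating maps. A commutative idempotent monoid `(Q, +, 0)` with its canonical order
(`r ≤ s` iff `r + s = s`) is the same thing as a join-semilattice with least element, with `+`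
being `⊔` and `0` being `⊥`; a rating map is a morphism of such monoids from `(2^{A*}, ∪, ∅)`
to `Q`. The rating set `Q` is required to be finite wherever rating maps are used. -/
abbrev RatingMap (A : Type u) (Q : Type v) [SemilatticeSup Q] [OrderBot Q] :=
  SupBotHom (Language A) Q

/-- `τ` is nice: for each nonempty language `K`, the value `τ(K)` is a finite sum of values `τ(w)`
with `w ∈ K` (addition in `Q` is `⊔`). -/
def RatingMap.IsNice (τ : RatingMap A Q) : Prop :=
  ∀ K : Language A, (∃ w, w ∈ K) →
    ∃ F : Finset (List A), (∀ w ∈ F, w ∈ K) ∧ τ K = F.sup fun w => τ {w}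

/-- `τ` is multiplicative: a morphism for the multiplication of the rating set as well. -/
def RatingMap.IsMultiplicative [MulOneClass Q] (τ : RatingMap A Q) : Prop :=
  τ {[]} = 1 ∧ ∀ K L : Language A, τ (K * L) = τ K * τ L

theorem RatingMap.mono (τ : RatingMap A Q) {K L : Language A} (h : K ≤ L) : τ K ≤ τ L :=
  OrderHomClass.mono τ h

/-- The `τ`-imprint of a finite set of languages. -/
def imprint (τ : RatingMap A Q) (𝒦 : Finset (Language A)) : Set Q :=
  {r | ∃ K ∈ 𝒦, r ≤ τ K}

/-- `𝒦` is an optimal `D`-cover of `L` for `τ`. -/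
def IsOptimalCover (D : BooleanSubalgebra (Language A)) (L : Language A) (τ : RatingMap A Q)
    (𝒦 : Finset (Language A)) : Prop :=
  IsCover D L 𝒦 ∧ ∀ 𝒦' : Finset (Language A), IsCover D L 𝒦' → imprint τ 𝒦 ⊆ imprint τ 𝒦'

theorem exists_isOptimalCover [Finite Q] (D : BooleanSubalgebra (Language A)) (L : Language A)
    (τ : RatingMap A Q) : ∃ 𝒦 : Finset (Language A), IsOptimalCover D L τ 𝒦 := by
  classical
  have hne : {I : Set Q | ∃ 𝒦, IsCover D L 𝒦 ∧ imprint τ 𝒦 = I}.Nonempty :=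
    ⟨_, {⊤}, ⟨by simp, fun w _ => ⟨⊤, by simp, Set.mem_univ w⟩⟩, rfl⟩
  obtain ⟨I, hI⟩ := (Set.toFinite {I : Set Q | ∃ 𝒦, IsCover D L 𝒦 ∧ imprint τ 𝒦 = I}).exists_minimal
    hne
  obtain ⟨𝒦, h𝒦, rfl⟩ := hI.prop
  refine ⟨𝒦, h𝒦, fun 𝒦' h𝒦' => ?_⟩
  let ℳ : Finset (Language A) := (𝒦 ×ˢ 𝒦').image fun p => p.1 ⊓ p.2
  have hM : IsCover D L ℳ := by
    constructor
    · intro M hM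
      obtain ⟨p, hp, rfl⟩ := Finset.mem_image.1 hM
      rw [Finset.mem_product] at hp
      exact D.inf_mem (h𝒦.1 _ hp.1) (h𝒦'.1 _ hp.2)
    · intro w hw
      obtain ⟨K, hK, hwK⟩ := h𝒦.2 w hw
      obtain ⟨K', hK', hwK'⟩ := h𝒦'.2 w hw
      exact ⟨K ⊓ K', Finset.mem_image.2 ⟨(K, K'), Finset.mem_product.2 ⟨hK, hK'⟩, rfl⟩,
        ⟨hwK, hwK'⟩⟩
  have h1 : imprint τ ℳ ⊆ imprint τ 𝒦 := by
    rintro r ⟨M, hM, hr⟩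
    obtain ⟨p, hp, rfl⟩ := Finset.mem_image.1 hM
    exact ⟨p.1, (Finset.mem_product.1 hp).1, hr.trans (τ.mono inf_le_left)⟩
  have h2 : imprint τ ℳ ⊆ imprint τ 𝒦' := by
    rintro r ⟨M, hM, hr⟩
    obtain ⟨p, hp, rfl⟩ := Finset.mem_image.1 hM
    exact ⟨p.2, (Finset.mem_product.1 hp).2, hr.trans (τ.mono inf_le_right)⟩
  exact (hI.le_of_le ⟨ℳ, hM, rfl⟩ h1).trans h2

/-- The `D`-optimal `τ`-imprint on `L`: the `τ`-imprint of an optimal `D`-cover of `L`. -/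
noncomputable def optimalImprint [Finite Q] (D : BooleanSubalgebra (Language A)) (L : Language A)
    (τ : RatingMap A Q) : Set Q :=
  imprint τ (exists_isOptimalCover D L τ).choose

/-- The optimal imprint does not depend on the optimal cover. -/
theorem optimalImprint_eq [Finite Q] {D : BooleanSubalgebra (Language A)} {L : Language A}
    {τ : RatingMap A Q} {𝒦 : Finset (Language A)} (h : IsOptimalCover D L τ 𝒦) :
    optimalImprint D L τ = imprint τ 𝒦 :=
  Set.Subset.antisymm ((exists_isOptimalCover D L τ).choose_spec.2 _ h.1)
    (h.2 _ (exists_isOptimalCover D L τ).choose_spec.1)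

theorem optimalImprint_subset [Finite Q] {D : BooleanSubalgebra (Language A)} {L : Language A}
    {τ : RatingMap A Q} {𝒦 : Finset (Language A)} (h : IsCover D L 𝒦) :
    optimalImprint D L τ ⊆ imprint τ 𝒦 :=
  (exists_isOptimalCover D L τ).choose_spec.2 _ h

theorem optimalImprint_mono [Finite Q] (D : BooleanSubalgebra (Language A)) {K L : Language A}
    (τ : RatingMap A Q) (h : K ≤ L) : optimalImprint D K τ ⊆ optimalImprint D L τ := by
  obtain ⟨𝒦, h𝒦⟩ := exists_isOptimalCover D L τ
  rw [optimalImprint_eq h𝒦]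
  exact optimalImprint_subset ⟨h𝒦.1.1, fun w hw => h𝒦.1.2 w (h hw)⟩

theorem optimalImprint_sup [Finite Q] (D : BooleanSubalgebra (Language A)) (K L : Language A)
    (τ : RatingMap A Q) :
    optimalImprint D (K ⊔ L) τ = optimalImprint D K τ ∪ optimalImprint D L τ := by
  classical
  refine Set.Subset.antisymm ?_ (Set.union_subset (optimalImprint_mono D τ le_sup_left)
    (optimalImprint_mono D τ le_sup_right))
  obtain ⟨𝒦, h𝒦⟩ := exists_isOptimalCover D K τ
  obtain ⟨ℒ, hℒ⟩ := exists_isOptimalCover D L τ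
  rw [optimalImprint_eq h𝒦, optimalImprint_eq hℒ]
  have hc : IsCover D (K ⊔ L) (𝒦 ∪ ℒ) := by
    constructor
    · intro M hM
      rcases Finset.mem_union.1 hM with h | h
      · exact h𝒦.1.1 M h
      · exact hℒ.1.1 M h
    · rintro w (hw | hw)
      · obtain ⟨M, hM, h⟩ := h𝒦.1.2 w hw
        exact ⟨M, Finset.mem_union_left _ hM, h⟩
      · obtain ⟨M, hM, h⟩ := hℒ.1.2 w hw
        exact ⟨M, Finset.mem_union_right _ hM, h⟩
  refine (optimalImprint_subset hc).trans ?_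
  rintro r ⟨M, hM, hr⟩
  rcases Finset.mem_union.1 hM with h | h
  · exact Or.inl ⟨M, h, hr⟩
  · exact Or.inr ⟨M, h, hr⟩

theorem optimalImprint_bot [Finite Q] (D : BooleanSubalgebra (Language A)) (τ : RatingMap A Q) :
    optimalImprint D ⊥ τ = ∅ := by
  have hc : IsCover D ⊥ ∅ := ⟨by simp, fun w hw => hw.elim⟩
  refine Set.subset_empty_iff.1 ((optimalImprint_subset hc).trans ?_)
  rintro r ⟨M, hM, -⟩
  simp at hM

/-- The nested rating map: it sends `K` to the `D`-optimal `τ`-imprint on `K`, and its rating set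
is `(2^Q, ∪)`. -/
noncomputable def nestedRatingMap [Finite Q] (D : BooleanSubalgebra (Language A))
    (τ : RatingMap A Q) : RatingMap A (Set Q) where
  toFun K := optimalImprint D K τ
  map_sup' K L := optimalImprint_sup D K L τ
  map_bot' := optimalImprint_bot D τ

/-- `L` is a `C`-optimal `ε`-approximation for `τ`. -/
def IsOptimalEpsApprox (C : BooleanSubalgebra (Language A)) (τ : RatingMap A Q)
    (L : Language A) : Prop :=
  L ∈ C ∧ [] ∈ L ∧ ∀ L' ∈ C, [] ∈ L' → τ L ≤ τ L'

theorem exists_isOptimalEpsApprox [Finite Q] (C : BooleanSubalgebra (Language A))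
    (τ : RatingMap A Q) : ∃ L : Language A, IsOptimalEpsApprox C τ L := by
  have hne : {q : Q | ∃ L ∈ C, [] ∈ L ∧ τ L = q}.Nonempty :=
    ⟨_, ⊤, C.top_mem, Set.mem_univ _, rfl⟩
  obtain ⟨q, hq⟩ := (Set.toFinite {q : Q | ∃ L ∈ C, [] ∈ L ∧ τ L = q}).exists_minimal hne
  obtain ⟨L, hL, hε, rfl⟩ := hq.prop
  refine ⟨L, hL, hε, fun L' hL' hε' => ?_⟩
  have h := hq.le_of_le ⟨L ⊓ L', C.inf_mem hL hL', ⟨hε, hε'⟩, rfl⟩ (τ.mono inf_le_left)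
  exact h.trans (τ.mono inf_le_right)

/-- The value `τ(L)` at a `C`-optimal `ε`-approximation `L` for `τ`. -/
noncomputable def epsApprox [Finite Q] (C : BooleanSubalgebra (Language A))
    (τ : RatingMap A Q) : Q :=
  τ (exists_isOptimalEpsApprox C τ).choose

/-- This value does not depend on the `C`-optimal `ε`-approximation. -/
theorem epsApprox_eq [Finite Q] {C : BooleanSubalgebra (Language A)} {τ : RatingMap A Q}
    {L : Language A} (h : IsOptimalEpsApprox C τ L) : epsApprox C τ = τ L :=
  have h' := (exists_isOptimalEpsApprox C τ).choose_spec
  le_antisymm (h'.2.2 L h.1 h.2.1) (h.2.2 _ h'.1 h'.2.1)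

end RatingMaps

/-! ## Complete subsets of the rating set -/

section Complete

theorem exists_pos_isIdempotentElem_pow (M : Type v) [Monoid M] [Finite M] :
    ∃ n : ℕ, 0 < n ∧ ∀ s : M, IsIdempotentElem (s ^ n) := by
  classical
  have h1 : ∀ s : M, ∃ n : ℕ, 0 < n ∧ IsIdempotentElem (s ^ n) := by
    intro s
    obtain ⟨i, j, hij, h⟩ := Set.infinite_univ.exists_lt_map_eq_of_mapsTo
      (f := fun n : ℕ => s ^ n) (fun _ _ => Set.mem_univ _) (Set.toFinite (Set.univ : Set M)) |>.imp
      fun i hi => by simpa using hi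
    obtain ⟨p, rfl⟩ := Nat.exists_eq_add_of_lt hij
    have hs : ∀ k m : ℕ, s ^ (i + m + k * (p + 1)) = s ^ (i + m) := by
      intro k
      induction k with
      | zero => simp
      | succ k ih =>
        intro m
        have : i + m + (k + 1) * (p + 1) = (i + p + 1) + (m + k * (p + 1)) := by ring
        rw [this, pow_add, ← h, ← pow_add, ← ih m]
        congr 1
        ring
    refine ⟨(i + 1) * (p + 1), by positivity, ?_⟩
    have hn : (i + 1) * (p + 1) = i + (i * p + p + 1) := by ring
    have := hs (i + 1) (i * p + p + 1)
    rw [← hn, pow_add] at this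
    exact this
  choose f hf hi using h1
  cases nonempty_fintype M
  refine ⟨∏ s, f s, Finset.prod_pos fun s _ => hf s, fun s => ?_⟩
  rw [← Finset.mul_prod_erase _ f (Finset.mem_univ s), pow_mul]
  exact (hi s).pow _

open Classical in
/-- The exponent `ω(M) ≥ 1` of a finite monoid `M`: `s ^ ω(M)` is idempotent for all `s`. (The value
of `s ^ ω` is the same for all such exponents.) -/
noncomputable def omegaExp (M : Type v) [Monoid M] [Finite M] : ℕ :=
  Nat.find (exists_pos_isIdempotentElem_pow M)

theorem omegaExp_pos (M : Type v) [Monoid M] [Finite M] : 0 < omegaExp M := by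
  classical
  exact (Nat.find_spec (exists_pos_isIdempotentElem_pow M)).1

theorem isIdempotentElem_pow_omegaExp {M : Type v} [Monoid M] [Finite M] (s : M) :
    IsIdempotentElem (s ^ omegaExp M) := by
  classical
  exact (Nat.find_spec (exists_pos_isIdempotentElem_pow M)).2 s

variable {A : Type u} {R : Type v} [IdemSemiring R]

/-- The value `η_{ρ,S}(w) = ∏ᵢ S · {ρ(aᵢ)} · S ⊆ R` at a word `w = a₁ ⋯ aₙ`, with the pointwise
multiplication of subsets of `R`; it is `{1}` at the empty word. -/
def etaWord (ρ : RatingMap A R) (S : Set R) (w : List A) : Set R :=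
  (w.map fun a => S * {ρ {[a]}} * S).prod

/-- The auxiliary rating map `η_{ρ,S}`: the nice multiplicative rating map with rating set `2^R`
(addition is union, multiplication is lifted from `R`) that sends each letter `a` to
`S · {ρ(a)} · S`. -/
def eta (ρ : RatingMap A R) (S : Set R) : RatingMap A (Set R) where
  toFun K := {r | ∃ w ∈ K, r ∈ etaWord ρ S w}
  map_sup' K L := by
    ext r
    constructor
    · rintro ⟨w, hw | hw, hr⟩
      · exact Or.inl ⟨w, hw, hr⟩
      · exact Or.inr ⟨w, hw, hr⟩
    · rintro (⟨w, hw, hr⟩ | ⟨w, hw, hr⟩)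
      · exact ⟨w, Or.inl hw, hr⟩
      · exact ⟨w, Or.inr hw, hr⟩
  map_bot' := Set.eq_empty_of_forall_notMem fun _ ⟨_, hw, _⟩ => hw

theorem mem_eta {ρ : RatingMap A R} {S : Set R} {K : Language A} {r : R} :
    r ∈ eta ρ S K ↔ ∃ w ∈ K, r ∈ etaWord ρ S w := Iff.rfl

theorem eta_singleton (ρ : RatingMap A R) (S : Set R) (w : List A) :
    eta ρ S {w} = etaWord ρ S w := by
  ext r
  exact ⟨fun ⟨_, hv, hr⟩ => (show _ = w from hv) ▸ hr, fun hr => ⟨w, rfl, hr⟩⟩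

theorem eta_letter (ρ : RatingMap A R) (S : Set R) (a : A) :
    eta ρ S {[a]} = S * {ρ {[a]}} * S := by
  simp [eta_singleton, etaWord]

theorem eta_isMultiplicative (ρ : RatingMap A R) (S : Set R) : (eta ρ S).IsMultiplicative := by
  constructor
  · simp [eta_singleton, etaWord]
  · intro K L
    ext r
    simp only [mem_eta, Set.mem_mul, Language.mem_mul]
    constructor
    · rintro ⟨_, ⟨x, hx, y, hy, rfl⟩, hr⟩
      rw [etaWord, List.map_append, List.prod_append] at hr
      obtain ⟨p, hp, q, hq, rfl⟩ := hr
      exact ⟨p, ⟨x, hx, hp⟩, q, ⟨y, hy, hq⟩, rfl⟩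
    · rintro ⟨p, ⟨x, hx, hp⟩, q, ⟨y, hy, hq⟩, rfl⟩
      refine ⟨x ++ y, ⟨x, hx, y, hy, rfl⟩, ?_⟩
      rw [etaWord, List.map_append, List.prod_append]
      exact Set.mul_mem_mul hp hq

theorem eta_isNice [Finite R] (ρ : RatingMap A R) (S : Set R) : (eta ρ S).IsNice := by
  classical
  intro K _
  choose f hf hr using fun r : eta ρ S K => mem_eta.1 r.2
  have : Fintype (eta ρ S K) := Fintype.ofFinite _
  refine ⟨Finset.univ.image f, ?_, ?_⟩
  · intro w hw
    obtain ⟨r, -, rfl⟩ := Finset.mem_image.1 hw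
    exact hf r
  · apply le_antisymm
    · intro r hrK
      have h : eta ρ S {f ⟨r, hrK⟩} ≤ (Finset.univ.image f).sup fun w => eta ρ S {w} :=
        Finset.le_sup (f := fun w => eta ρ S {w}) (Finset.mem_image_of_mem f (Finset.mem_univ _))
      exact h (by rw [eta_singleton]; exact hr ⟨r, hrK⟩)
    · refine Finset.sup_le fun w hw => (eta ρ S).mono ?_
      obtain ⟨r, -, rfl⟩ := Finset.mem_image.1 hw
      rintro _ rfl
      exact hf r

/-- `S ⊆ R` is `SF(C)`-complete for `ρ`. -/
structure IsComplete [Finite R] (C : BooleanSubalgebra (Language A)) (ρ : RatingMap A R)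
    (S : Set R) : Prop where
  downset : ∀ r ∈ S, ∀ q : R, q ≤ r → q ∈ S
  mul : ∀ q ∈ S, ∀ r ∈ S, q * r ∈ S
  operation : epsApprox C (eta ρ S) ⊆ S
  closure : ∀ r ∈ S, r ^ omegaExp R + r ^ (omegaExp R + 1) ∈ S

end Complete

end StarFreeClosure

namespace StarFreeClosure

universe u v

/-! ## Boolean algebras of languages and star-free closures -/

section Boolean

variable {A : Type u}

/-! Completeness. An element `r` lies in `ι_C[ξ]` exactly when, for each `N ∈ C` containing `ε` and
each morphism `β` into a finite monoid with star-free fibres, some `w ∈ N` satisfies `r ≤ ρ(β⁻¹(β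
w))` (`mem_epsApprox_nested_iff`). Since `C` consists of group languages, `N` can be shrunk to the
kernel of a morphism `α` into a finite group with preimages in `C`. Such kernels are closed under
concatenation, which gives condition 2; in a word of the kernel, inserting kernel words keeps it in
the kernel, which gives condition 3. Condition 4 holds because star-free languages over `C` are
aperiodic along the words of some `N ∈ C` containing `ε` (`exists_aperiodic`): for such `u` and
large `n`, `uⁿ` and `uⁿ⁺¹` share a fibre of `β`.

Minimality. Given a complete `S`, let `α : A* → G` recognize an optimal `ε`-approximation for
`η_{ρ,S}`. The pairs `(α w, r)` with `r ∈ Sρ(a₁)S⋯Sρ(aₙ)S` and `w = a₁⋯aₙ` form a submonoid `T` of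
`G × R` whose elements of degree `1` are exactly those of `S`. The core is `hasStarFreeBound`: a map
on words over the letters of `T`, with finitely many values, star-free fibres and values in `T`,
bounds each product from above and keeps its degree. Its fibres of degree `1` pull back to a
star-free cover of `α⁻¹(1)`, and niceness bounds the rating of each nonempty member by an element of
`S`.

The bound is found by induction on the size of a set `X ⊆ R` on which `T` acts from the right, then
on the alphabet. If all letters act injectively, condition 4 gives one bound per degree. Otherwise
words are cut at a letter `b` acting non-injectively; the blocks between two occurrences use the
smaller alphabet, and the sequence of blocks acts on the smaller set `Xb`. Taking `G × R` as
alphabet lets each block be recoded as one letter. -/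

theorem mem_of_forall_mem_iff {D : BooleanSubalgebra (Language A)} {K L : Language A}
    (hK : K ∈ D) (h : ∀ w, w ∈ L ↔ w ∈ K) : L ∈ D := by
  obtain rfl : L = K := Set.ext h
  exact hK

theorem setOf_exists_mem {ι : Type*} [Finite ι] {D : BooleanSubalgebra (Language A)}
    {L : ι → Language A} (h : ∀ i, L i ∈ D) : ({w | ∃ i, w ∈ L i} : Language A) ∈ D := by
  classical
  cases nonempty_fintype ι
  have key : ∀ s : Finset ι, ({w | ∃ i ∈ s, w ∈ L i} : Language A) ∈ D := by
    intro s
    induction s using Finset.induction_on with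
    | empty =>
      refine mem_of_forall_mem_iff D.bot_mem fun w => ⟨?_, fun h => h.elim⟩
      rintro ⟨i, hi, -⟩
      simp at hi
    | insert a s ha ih =>
      refine mem_of_forall_mem_iff (D.sup_mem (h a) ih) fun w => ⟨?_, ?_⟩
      · rintro ⟨i, hi, hw⟩
        rcases Finset.mem_insert.1 hi with rfl | hi
        · exact Or.inl hw
        · exact Or.inr ⟨i, hi, hw⟩
      · rintro (hw | ⟨i, hi, hw⟩)
        · exact ⟨a, Finset.mem_insert_self _ _, hw⟩
        · exact ⟨i, Finset.mem_insert_of_mem hi, hw⟩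
  refine mem_of_forall_mem_iff (key Finset.univ) fun w => ⟨?_, ?_⟩
  · rintro ⟨i, hw⟩
    exact ⟨i, Finset.mem_univ i, hw⟩
  · rintro ⟨i, -, hw⟩
    exact ⟨i, hw⟩

theorem setOf_forall_mem {ι : Type*} [Finite ι] {D : BooleanSubalgebra (Language A)}
    {L : ι → Language A} (h : ∀ i, L i ∈ D) : ({w | ∀ i, w ∈ L i} : Language A) ∈ D := by
  refine mem_of_forall_mem_iff (D.compl_mem (setOf_exists_mem fun i => D.compl_mem (h i)))
    fun w => ?_
  change (∀ i, w ∈ L i) ↔ ¬ ∃ i, ¬ w ∈ L i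
  push Not
  rfl

/-- If all fibres of a map into a finite type belong to a Boolean algebra, so do all preimages. -/
theorem preimage_mem {β : Type*} [Finite β] {D : BooleanSubalgebra (Language A)}
    {f : List A → β} (h : ∀ b, ({w | f w = b} : Language A) ∈ D) (s : Set β) :
    ({w | f w ∈ s} : Language A) ∈ D := by
  refine mem_of_forall_mem_iff (setOf_exists_mem (ι := s) fun b => h b) fun w => ⟨?_, ?_⟩
  · intro hw
    exact ⟨⟨f w, hw⟩, rfl⟩
  · rintro ⟨⟨b, hb⟩, hw⟩
    change f w = b at hw
    change f w ∈ s
    rwa [hw]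

theorem setOf_iff_mem {D : BooleanSubalgebra (Language A)} {L : Language A} (hL : L ∈ D)
    (p : Prop) : ({w | w ∈ L ↔ p} : Language A) ∈ D := by
  by_cases hp : p
  · exact mem_of_forall_mem_iff hL fun w => iff_of_eq (by simp [hp]; rfl)
  · exact mem_of_forall_mem_iff (D.compl_mem hL) fun w => iff_of_eq (by simp [hp]; rfl)

variable {C : BooleanSubalgebra (Language A)}

theorem mul_mem_starFreeClosure {K L : Language A} (hK : K ∈ starFreeClosure C)
    (hL : L ∈ starFreeClosure C) : K * L ∈ starFreeClosure C :=
  InStarFree.concat hK hL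

theorem letter_mem_starFreeClosure (a : A) : ({[a]} : Language A) ∈ starFreeClosure C :=
  InStarFree.letter a

theorem setOf_letters_mem_starFreeClosure [Finite A] (B : Set A) :
    ({w | ∀ x ∈ w, x ∈ B} : Language A) ∈ starFreeClosure C := by
  have h : ∀ x : (Bᶜ : Set A), (⊤ * {[x.1]} * ⊤ : Language A) ∈ starFreeClosure C := fun x =>
    mul_mem_starFreeClosure (mul_mem_starFreeClosure (BooleanSubalgebra.top_mem)
      (letter_mem_starFreeClosure _)) (BooleanSubalgebra.top_mem)
  refine mem_of_forall_mem_iff (BooleanSubalgebra.compl_mem (setOf_exists_mem h)) fun w => ?_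
  change (∀ x ∈ w, x ∈ B) ↔ ¬ ∃ x : (Bᶜ : Set A), w ∈ (⊤ * {[x.1]} * ⊤ : Language A)
  constructor
  · rintro hw ⟨⟨x, hx⟩, hwx⟩
    obtain ⟨_, ⟨p, -, _, rfl, rfl⟩, q, -, rfl⟩ := hwx
    exact hx (hw x (by simp))
  · intro hw x hx
    by_contra hxB
    obtain ⟨p, q, rfl⟩ := List.append_of_mem hx
    exact hw ⟨⟨x, hxB⟩, p ++ [x], ⟨p, trivial, [x], rfl, rfl⟩, q, trivial, by simp⟩

theorem nil_mem_starFreeClosure [Finite A] : ({[]} : Language A) ∈ starFreeClosure C := by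
  refine mem_of_forall_mem_iff (setOf_letters_mem_starFreeClosure ∅) fun w => ?_
  change w = [] ↔ ∀ x ∈ w, x ∈ (∅ : Set A)
  exact ⟨by rintro rfl; simp, fun h => List.eq_nil_iff_forall_not_mem.2 h⟩

end Boolean

/-! ## Two-sided quotients and recognition -/

section Quotients

variable {A : Type u}

/-- The two-sided quotient `u⁻¹Lv⁻¹ = {w | uwv ∈ L}`. -/
def twoSidedQuotient (L : Language A) (p : List A × List A) : Language A :=
  {w | p.1 ++ w ++ p.2 ∈ L}

theorem mem_twoSidedQuotient {L : Language A} {p : List A × List A} {w : List A} :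
    w ∈ twoSidedQuotient L p ↔ p.1 ++ w ++ p.2 ∈ L := Iff.rfl

theorem twoSidedQuotient_nil (L : Language A) : twoSidedQuotient L ([], []) = L := by
  ext w
  simp [mem_twoSidedQuotient]

theorem twoSidedQuotient_twoSidedQuotient (L : Language A) (p q : List A × List A) :
    twoSidedQuotient (twoSidedQuotient L p) q = twoSidedQuotient L (p.1 ++ q.1, q.2 ++ p.2) := by
  ext w
  simp [mem_twoSidedQuotient]

theorem QuotientClosed.twoSidedQuotient_mem {C : Set (Language A)} (h : QuotientClosed C)
    {L : Language A} (hL : L ∈ C) (p : List A × List A) : twoSidedQuotient L p ∈ C := by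
  have h1 := (h _ (h L hL p.1).1 p.2).2
  have h2 : twoSidedQuotient L p = rightQuotient (L.leftQuotient p.1) p.2 := by
    ext w
    change p.1 ++ w ++ p.2 ∈ L ↔ p.1 ++ (w ++ p.2) ∈ L
    rw [List.append_assoc]
  rwa [h2]

/-- The three cases are the places where the cut between `K` and `L` can fall in `uwv`: inside `u`,
inside `w`, or inside `v`. -/
theorem mem_twoSidedQuotient_mul {K L : Language A} {p : List A × List A} {w : List A} :
    w ∈ twoSidedQuotient (K * L) p ↔
      (∃ u₁ u₂, u₁ ++ u₂ = p.1 ∧ u₁ ∈ K ∧ w ∈ twoSidedQuotient L (u₂, p.2)) ∨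
      w ∈ twoSidedQuotient K (p.1, []) * twoSidedQuotient L ([], p.2) ∨
      ∃ v₁ v₂, v₁ ++ v₂ = p.2 ∧ v₂ ∈ L ∧ w ∈ twoSidedQuotient K (p.1, v₁) := by
  obtain ⟨u, v⟩ := p
  simp only [mem_twoSidedQuotient, Language.mem_mul]
  constructor
  · rintro ⟨x, hx, y, hy, hxy⟩
    rw [List.append_assoc, List.append_eq_append_iff] at hxy
    rcases hxy with ⟨c, rfl, rfl⟩ | ⟨c, rfl, hc⟩
    · exact Or.inl ⟨x, c, rfl, hx, by simpa using hy⟩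
    · rcases List.append_eq_append_iff.1 hc with ⟨d, rfl, rfl⟩ | ⟨d, rfl, rfl⟩
      · exact Or.inr (Or.inr ⟨d, y, rfl, hy, by simpa using hx⟩)
      · exact Or.inr (Or.inl ⟨c, by simpa using hx, d, by simpa using hy, rfl⟩)
  · rintro (⟨u₁, u₂, rfl, hu, hw⟩ | ⟨x, hx, y, hy, rfl⟩ | ⟨v₁, v₂, rfl, hv, hw⟩)
    · exact ⟨u₁, hu, _, hw, by simp⟩
    · exact ⟨_, hx, _, hy, by simp⟩
    · exact ⟨_, hw, v₂, hv, by simp⟩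

theorem IsGroupLanguage.finite_range_twoSidedQuotient {L : Language A} (h : IsGroupLanguage L) :
    (Set.range (twoSidedQuotient L)).Finite := by
  obtain ⟨G, _, _, α, F, hF⟩ := h
  refine (Set.toFinite (Set.range fun g : G × G =>
    ({w | g.1 * α (FreeMonoid.ofList w) * g.2 ∈ F} : Language A))).subset ?_
  rintro _ ⟨p, rfl⟩
  refine ⟨(α (FreeMonoid.ofList p.1), α (FreeMonoid.ofList p.2)), ?_⟩
  refine Set.ext fun w => Iff.symm ?_
  change p.1 ++ w ++ p.2 ∈ L ↔ _
  rw [hF, FreeMonoid.ofList_append, FreeMonoid.ofList_append, map_mul,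
    map_mul]
  rfl

/-- By `mem_twoSidedQuotient_mul`, a quotient of `KL` is determined by one quotient of each factor
and one set of quotients of each factor, so finitely many values are possible. -/
theorem finite_range_twoSidedQuotient_mul {K L : Language A}
    (hK : (Set.range (twoSidedQuotient K)).Finite) (hL : (Set.range (twoSidedQuotient L)).Finite) :
    (Set.range (twoSidedQuotient (K * L))).Finite := by
  have hfin := (((hL.powerset.prod hK).prod hL).prod hK.powerset).image
    fun x : ((Set (Language A) × Language A) × Language A) × Set (Language A) =>
      ({w | (∃ Q ∈ x.1.1.1, w ∈ Q) ∨ w ∈ x.1.1.2 * x.1.2 ∨ ∃ Q ∈ x.2, w ∈ Q} : Language A)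
  refine hfin.subset ?_
  rintro _ ⟨p, rfl⟩
  refine ⟨((({Q | ∃ u₁ u₂, u₁ ++ u₂ = p.1 ∧ u₁ ∈ K ∧ Q = twoSidedQuotient L (u₂, p.2)},
    twoSidedQuotient K (p.1, [])), twoSidedQuotient L ([], p.2)),
    {Q | ∃ v₁ v₂, v₁ ++ v₂ = p.2 ∧ v₂ ∈ L ∧ Q = twoSidedQuotient K (p.1, v₁)}),
    ⟨⟨⟨?_, ⟨_, rfl⟩⟩, ⟨_, rfl⟩⟩, ?_⟩, ?_⟩
  · rintro _ ⟨u₁, u₂, -, -, rfl⟩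
    exact ⟨_, rfl⟩
  · rintro _ ⟨u₁, u₂, -, -, rfl⟩
    exact ⟨_, rfl⟩
  · refine Set.ext fun w => Iff.trans ?_ mem_twoSidedQuotient_mul.symm
    refine or_congr ⟨?_, ?_⟩ (or_congr Iff.rfl ⟨?_, ?_⟩)
    · rintro ⟨_, ⟨u₁, u₂, h1, h2, rfl⟩, hw⟩
      exact ⟨u₁, u₂, h1, h2, hw⟩
    · rintro ⟨u₁, u₂, h1, h2, hw⟩
      exact ⟨_, ⟨u₁, u₂, h1, h2, rfl⟩, hw⟩
    · rintro ⟨_, ⟨u₁, u₂, h1, h2, rfl⟩, hw⟩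
      exact ⟨u₁, u₂, h1, h2, hw⟩
    · rintro ⟨u₁, u₂, h1, h2, hw⟩
      exact ⟨_, ⟨u₁, u₂, h1, h2, rfl⟩, hw⟩

variable {C : BooleanSubalgebra (Language A)}

theorem twoSidedQuotient_letter_mem_starFreeClosure [Finite A] (a : A) (p : List A × List A) :
    twoSidedQuotient {[a]} p ∈ starFreeClosure C := by
  have hf : (Set.Finite {w : List A | w.length ≤ 1}) := List.finite_length_le A 1
  have : Finite {w : List A | w.length ≤ 1} := hf
  have key : ∀ w : {w : List A | w.length ≤ 1}, ({w.1} : Language A) ∈ starFreeClosure C := by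
    rintro ⟨w, hw⟩
    match w, hw with
    | [], _ => exact nil_mem_starFreeClosure
    | [b], _ => exact letter_mem_starFreeClosure b
  refine mem_of_forall_mem_iff (setOf_exists_mem
    (ι := {w : {w : List A | w.length ≤ 1} // w.1 ∈ twoSidedQuotient {[a]} p})
    fun w => key w.1) fun w => ⟨fun hw => ?_, ?_⟩
  · have hl : w.length ≤ 1 := by
      have h : p.1 ++ w ++ p.2 = [a] := hw
      have := congrArg List.length h
      simp only [List.length_append, List.length_cons, List.length_nil] at this
      omega
    exact ⟨⟨⟨w, hl⟩, hw⟩, rfl⟩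
  · rintro ⟨⟨⟨w', _⟩, hw'⟩, rfl⟩
    exact hw'

/-- Star-free languages over a quotient-closed algebra of regular languages have finitely many
two-sided quotients, all of them star-free over that algebra. -/
theorem twoSidedQuotient_starFreeClosure [Finite A]
    (hC : ∀ L ∈ C, (Set.range (twoSidedQuotient L)).Finite ∧ ∀ p, twoSidedQuotient L p ∈ C)
    {L : Language A} (hL : L ∈ starFreeClosure C) :
    (Set.range (twoSidedQuotient L)).Finite ∧
      ∀ p, twoSidedQuotient L p ∈ starFreeClosure C := by
  induction hL with
  | base hL => exact ⟨(hC _ hL).1, fun p => InStarFree.base ((hC _ hL).2 p)⟩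
  | letter a =>
    refine ⟨?_, twoSidedQuotient_letter_mem_starFreeClosure a⟩
    refine (List.finite_length_le A 1).powerset.subset ?_
    rintro _ ⟨p, rfl⟩ w hw
    have h : p.1 ++ w ++ p.2 = [a] := hw
    have := congrArg List.length h
    simp only [List.length_append, List.length_cons, List.length_nil] at this
    change w.length ≤ 1
    omega
  | union _ _ ihK ihL =>
    refine ⟨(ihK.1.image2 (· ⊔ ·) ihL.1).subset ?_, fun p => InStarFree.union (ihK.2 p) (ihL.2 p)⟩
    rintro _ ⟨p, rfl⟩
    exact ⟨_, ⟨p, rfl⟩, _, ⟨p, rfl⟩, rfl⟩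
  | inter _ _ ihK ihL =>
    refine ⟨(ihK.1.image2 (· ⊓ ·) ihL.1).subset ?_, fun p => InStarFree.inter (ihK.2 p) (ihL.2 p)⟩
    rintro _ ⟨p, rfl⟩
    exact ⟨_, ⟨p, rfl⟩, _, ⟨p, rfl⟩, rfl⟩
  | compl _ ih =>
    refine ⟨(ih.1.image (·ᶜ)).subset ?_, fun p => InStarFree.compl (ih.2 p)⟩
    rintro _ ⟨p, rfl⟩
    exact ⟨_, ⟨p, rfl⟩, rfl⟩
  | @concat K L _ _ ihK ihL =>
    refine ⟨finite_range_twoSidedQuotient_mul ihK.1 ihL.1, fun p => ?_⟩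
    have h1 : ({w | ∃ Q ∈ {Q | ∃ u₁ u₂, u₁ ++ u₂ = p.1 ∧ u₁ ∈ K ∧
        Q = twoSidedQuotient L (u₂, p.2)}, w ∈ Q} : Language A) ∈ starFreeClosure C := by
      have hfin : Finite {Q | ∃ u₁ u₂, u₁ ++ u₂ = p.1 ∧ u₁ ∈ K ∧
          Q = twoSidedQuotient L (u₂, p.2)} := by
        refine ihL.1.subset ?_
        rintro _ ⟨u₁, u₂, -, -, rfl⟩
        exact ⟨_, rfl⟩
      refine mem_of_forall_mem_iff (setOf_exists_mem (L := fun Q : {Q | ∃ u₁ u₂, u₁ ++ u₂ = p.1 ∧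
        u₁ ∈ K ∧ Q = twoSidedQuotient L (u₂, p.2)} => Q.1) ?_) fun w => ?_
      · rintro ⟨_, u₁, u₂, -, -, rfl⟩
        exact ihL.2 _
      · exact ⟨fun ⟨Q, hQ, hw⟩ => ⟨⟨Q, hQ⟩, hw⟩, fun ⟨Q, hw⟩ => ⟨Q.1, Q.2, hw⟩⟩
    have h2 : ({w | ∃ Q ∈ {Q | ∃ v₁ v₂, v₁ ++ v₂ = p.2 ∧ v₂ ∈ L ∧
        Q = twoSidedQuotient K (p.1, v₁)}, w ∈ Q} : Language A) ∈ starFreeClosure C := by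
      have hfin : Finite {Q | ∃ v₁ v₂, v₁ ++ v₂ = p.2 ∧ v₂ ∈ L ∧
          Q = twoSidedQuotient K (p.1, v₁)} := by
        refine ihK.1.subset ?_
        rintro _ ⟨u₁, u₂, -, -, rfl⟩
        exact ⟨_, rfl⟩
      refine mem_of_forall_mem_iff (setOf_exists_mem (L := fun Q : {Q | ∃ v₁ v₂, v₁ ++ v₂ = p.2 ∧
        v₂ ∈ L ∧ Q = twoSidedQuotient K (p.1, v₁)} => Q.1) ?_) fun w => ?_
      · rintro ⟨_, u₁, u₂, -, -, rfl⟩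
        exact ihK.2 _
      · exact ⟨fun ⟨Q, hQ, hw⟩ => ⟨⟨Q, hQ⟩, hw⟩, fun ⟨Q, hw⟩ => ⟨Q.1, Q.2, hw⟩⟩
    refine mem_of_forall_mem_iff (BooleanSubalgebra.sup_mem h1 (BooleanSubalgebra.sup_mem
      (mul_mem_starFreeClosure (ihK.2 (p.1, [])) (ihL.2 ([], p.2))) h2)) fun w => ?_
    rw [mem_twoSidedQuotient_mul]
    refine or_congr ⟨?_, ?_⟩ (or_congr Iff.rfl ⟨?_, ?_⟩)
    · rintro ⟨u₁, u₂, h1, h2, hw⟩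
      exact ⟨_, ⟨u₁, u₂, h1, h2, rfl⟩, hw⟩
    · rintro ⟨_, ⟨u₁, u₂, h1, h2, rfl⟩, hw⟩
      exact ⟨u₁, u₂, h1, h2, hw⟩
    · rintro ⟨u₁, u₂, h1, h2, hw⟩
      exact ⟨_, ⟨u₁, u₂, h1, h2, rfl⟩, hw⟩
    · rintro ⟨_, ⟨u₁, u₂, h1, h2, rfl⟩, hw⟩
      exact ⟨u₁, u₂, h1, h2, hw⟩

/-- The syntactic congruence of a family of languages that is closed under quotients. -/
def syntacticCon (𝒬 : Set (Language A)) (h𝒬 : ∀ Q ∈ 𝒬, ∀ p, twoSidedQuotient Q p ∈ 𝒬) :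
    Con (FreeMonoid A) where
  r x y := ∀ Q ∈ 𝒬, x.toList ∈ Q ↔ y.toList ∈ Q
  iseqv := ⟨fun _ _ _ => Iff.rfl, fun h Q hQ => (h Q hQ).symm,
    fun h h' Q hQ => (h Q hQ).trans (h' Q hQ)⟩
  mul' := by
    intro w x y z h h' Q hQ
    have h1 := h _ (h𝒬 Q hQ ([], y.toList))
    have h2 := h' _ (h𝒬 Q hQ (x.toList, []))
    simp only [mem_twoSidedQuotient, List.nil_append, List.append_nil] at h1 h2
    rw [FreeMonoid.toList_mul, FreeMonoid.toList_mul]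
    exact h1.trans h2

/-- A finite quotient-closed family of languages in a Boolean algebra `D` is recognized by a
surjective morphism onto a finite monoid all of whose fibres belong to `D`. -/
theorem exists_recognizer {D : BooleanSubalgebra (Language A)} {𝒬 : Set (Language A)}
    (hfin : 𝒬.Finite) (hD : 𝒬 ⊆ D) (h𝒬 : ∀ Q ∈ 𝒬, ∀ p, twoSidedQuotient Q p ∈ 𝒬) :
    ∃ (M : Type u) (_ : Monoid M) (_ : Finite M) (β : FreeMonoid A →* M),
      Function.Surjective β ∧ (∀ m, ({w | β (FreeMonoid.ofList w) = m} : Language A) ∈ D) ∧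
      ∀ x y, β x = β y ↔ ∀ Q ∈ 𝒬, x.toList ∈ Q ↔ y.toList ∈ Q := by
  have : Finite 𝒬 := hfin
  let c := syntacticCon 𝒬 h𝒬
  have hc : ∀ x y, c.mk' x = c.mk' y ↔ ∀ Q ∈ 𝒬, x.toList ∈ Q ↔ y.toList ∈ Q := fun x y => c.eq
  have hsurj : Function.Surjective c.mk' := c.mk'_surjective
  refine ⟨c.Quotient, inferInstance, ?_, c.mk', hsurj, fun m => ?_, hc⟩
  · choose g hg using hsurj
    refine Finite.of_injective
      (fun m : c.Quotient => ({Q | (g m).toList ∈ Q.1} : Set 𝒬)) fun m m' hm => ?_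
    rw [← hg m, ← hg m', hc]
    intro Q hQ
    exact Set.ext_iff.1 hm ⟨Q, hQ⟩
  · obtain ⟨x, rfl⟩ := hsurj m
    refine mem_of_forall_mem_iff (setOf_forall_mem (ι := 𝒬)
      fun Q => setOf_iff_mem (hD Q.2) (x.toList ∈ Q.1)) fun w => ?_
    change c.mk' (FreeMonoid.ofList w) = c.mk' x ↔ ∀ Q : 𝒬, _
    rw [hc]
    exact ⟨fun h Q => h Q.1 Q.2, fun h Q hQ => h ⟨Q, hQ⟩⟩

/-- A group language in a quotient-closed Boolean algebra `C` is recognized by a morphism into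
a finite group all of whose preimages belong to `C`. -/
theorem exists_group_recognizer (hquot : QuotientClosed (C : Set (Language A)))
    {L : Language A} (hL : L ∈ C) (hg : IsGroupLanguage L) :
    ∃ (G : Type u) (_ : Group G) (_ : Finite G) (α : FreeMonoid A →* G),
      (∀ F : Set G, ({w | α (FreeMonoid.ofList w) ∈ F} : Language A) ∈ C) ∧
      ∀ v w : List A, α (FreeMonoid.ofList v) = α (FreeMonoid.ofList w) → (v ∈ L ↔ w ∈ L) := by
  obtain ⟨M, _, _, β, hsurj, hfib, hβ⟩ := exists_recognizer (D := C)
    hg.finite_range_twoSidedQuotient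
    (by rintro _ ⟨p, rfl⟩; exact hquot.twoSidedQuotient_mem hL p)
    (by rintro _ ⟨p, rfl⟩ q; exact ⟨_, (twoSidedQuotient_twoSidedQuotient L p q).symm⟩)
  have hunit : ∀ m : M, IsUnit m := by
    intro m
    obtain ⟨x, rfl⟩ := hsurj m
    obtain ⟨H, _, _, γ, F, hF⟩ := hg
    -- The group `H` given for `L` need not have preimages in `C`, so the syntactic monoid is used
    -- and shown to be a group: `x ^ |H|` is trivial in `H`, hence syntactically equivalent to `ε`.
    have : β (x ^ Nat.card H) = β 1 := by
      rw [hβ]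
      rintro _ ⟨p, rfl⟩
      have hx : γ (x ^ Nat.card H) = 1 := by rw [map_pow, pow_card_eq_one']
      simp only [mem_twoSidedQuotient, hF, FreeMonoid.ofList_append, FreeMonoid.ofList_toList,
        map_mul, hx, map_one]
    rw [map_pow, map_one] at this
    exact IsUnit.of_pow_eq_one this Nat.card_pos.ne'
  refine ⟨M, groupOfIsUnit hunit, inferInstance, β, fun F => ?_, fun v w hvw => ?_⟩
  · exact preimage_mem hfib F
  · have := (hβ _ _).1 hvw L ⟨([], []), twoSidedQuotient_nil L⟩
    simpa using this

end Quotients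

/-! ## The optimal approximation is complete -/

section Soundness

variable {A : Type u} {R : Type v}

theorem epsApprox_le {Q : Type v} [SemilatticeSup Q] [OrderBot Q] [Finite Q]
    {C : BooleanSubalgebra (Language A)} {τ : RatingMap A Q} {L : Language A} (hL : L ∈ C)
    (hε : [] ∈ L) : epsApprox C τ ≤ τ L :=
  (exists_isOptimalEpsApprox C τ).choose_spec.2.2 L hL hε

theorem le_epsApprox {Q : Type v} [SemilatticeSup Q] [OrderBot Q] [Finite Q]
    {C : BooleanSubalgebra (Language A)} {τ : RatingMap A Q} {q : Q}
    (h : ∀ L ∈ C, [] ∈ L → q ≤ τ L) : q ≤ epsApprox C τ :=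
  have h' := (exists_isOptimalEpsApprox C τ).choose_spec
  h _ h'.1 h'.2.1

/-- The language of all words with the same image as `w`. -/
def fiber {M : Type*} [Monoid M] (β : FreeMonoid A →* M) (w : List A) : Language A :=
  {v | β (FreeMonoid.ofList v) = β (FreeMonoid.ofList w)}

theorem fiber_mul_le {M : Type*} [Monoid M] (β : FreeMonoid A →* M) (v w : List A) :
    fiber β v * fiber β w ≤ fiber β (v ++ w) := by
  rintro _ ⟨x, hx, y, hy, rfl⟩
  change β (FreeMonoid.ofList (x ++ y)) = β (FreeMonoid.ofList (v ++ w))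
  rw [FreeMonoid.ofList_append, FreeMonoid.ofList_append, map_mul, map_mul, show β _ = _ from hx,
    show β _ = _ from hy]

/-- Membership in optimal imprints through morphisms into finite monoids. -/
theorem mem_optimalImprint_iff [SemilatticeSup R] [OrderBot R] [Finite R]
    {D : BooleanSubalgebra (Language A)}
    (hD : ∀ K ∈ D, (Set.range (twoSidedQuotient K)).Finite ∧ ∀ p, twoSidedQuotient K p ∈ D)
    {ρ : RatingMap A R} {L : Language A} {r : R} :
    r ∈ optimalImprint D L ρ ↔
      ∀ (M : Type u) [Monoid M] [Finite M] (β : FreeMonoid A →* M),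
        (∀ w, fiber β w ∈ D) → ∃ w ∈ L, r ≤ ρ (fiber β w) := by
  classical
  constructor
  · intro hr M _ _ β hβ
    have hfin : (fiber β '' {w | w ∈ L}).Finite := by
      refine (Set.toFinite (Set.range fun m : M =>
        ({v | β (FreeMonoid.ofList v) = m} : Language A))).subset ?_
      rintro _ ⟨w, -, rfl⟩
      exact ⟨_, rfl⟩
    have hc : IsCover D L hfin.toFinset := by
      constructor
      · intro K hK
        obtain ⟨w, -, rfl⟩ := hfin.mem_toFinset.1 hK
        exact hβ w
      · intro w hw
        exact ⟨fiber β w, hfin.mem_toFinset.2 ⟨w, hw, rfl⟩, rfl⟩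
    obtain ⟨K, hK, hr⟩ := optimalImprint_subset hc hr
    obtain ⟨w, hw, rfl⟩ := hfin.mem_toFinset.1 hK
    exact ⟨w, hw, hr⟩
  · intro h
    obtain ⟨𝒦, h𝒦⟩ := exists_isOptimalCover D L ρ
    rw [optimalImprint_eq h𝒦]
    -- A morphism recognizing all quotients of the members of an optimal cover has fibres that
    -- refine this cover.
    have hfin : (⋃ K ∈ 𝒦, Set.range (twoSidedQuotient K)).Finite :=
      𝒦.finite_toSet.biUnion fun K hK => (hD K (h𝒦.1.1 K hK)).1
    obtain ⟨M, _, _, β, -, hfib, hβ⟩ := exists_recognizer (D := D) hfin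
      (by
        intro Q hQ
        simp only [Set.mem_iUnion] at hQ
        obtain ⟨K, hK, p, rfl⟩ := hQ
        exact (hD K (h𝒦.1.1 K hK)).2 p)
      (by
        intro Q hQ q
        simp only [Set.mem_iUnion] at hQ ⊢
        obtain ⟨K, hK, p, rfl⟩ := hQ
        exact ⟨K, hK, _, (twoSidedQuotient_twoSidedQuotient K p q).symm⟩)
    obtain ⟨w, hw, hr⟩ := h M β fun w => hfib _
    obtain ⟨K, hK, hwK⟩ := h𝒦.1.2 w hw
    refine ⟨K, hK, hr.trans (ρ.mono fun v hv => ?_)⟩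
    have h1 := (hβ _ _).1 hv K (Set.mem_biUnion hK ⟨([], []), twoSidedQuotient_nil K⟩)
    exact h1.2 hwK

variable {C : BooleanSubalgebra (Language A)}

/-! ### Aperiodicity of star-free languages relative to `C` -/

/-- The word `uⁿ`. -/
def wordPow (u : List A) (n : ℕ) : List A := (List.replicate n u).flatten

theorem wordPow_add (u : List A) (m n : ℕ) : wordPow u (m + n) = wordPow u m ++ wordPow u n := by
  rw [wordPow, List.replicate_add, List.flatten_append]
  rfl

theorem wordPow_one (u : List A) : wordPow u 1 = u := by simp [wordPow]

theorem ofList_wordPow (u : List A) (n : ℕ) :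
    FreeMonoid.ofList (wordPow u n) = FreeMonoid.ofList u ^ n := by
  induction n with
  | zero => rfl
  | succ n ih => rw [wordPow_add, wordPow_one, FreeMonoid.ofList_append, ih, pow_succ]

theorem length_wordPow (u : List A) (n : ℕ) : (wordPow u n).length = n * u.length := by
  simp [wordPow]

/-- Wherever the cut between `K` and `L` falls, enough copies of `u` lie entirely on one side, and
the pumping is done there. -/
theorem append_wordPow_mem_mul_iff {K L : Language A} {u : List A} {k l : ℕ}
    (hK : ∀ n ≥ k, ∀ x y, x ++ wordPow u n ++ y ∈ K ↔ x ++ wordPow u (n + 1) ++ y ∈ K)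
    (hL : ∀ n ≥ l, ∀ x y, x ++ wordPow u n ++ y ∈ L ↔ x ++ wordPow u (n + 1) ++ y ∈ L)
    {n : ℕ} (hn : n ≥ k + l + 1) (x y : List A) :
    x ++ wordPow u n ++ y ∈ K * L ↔ x ++ wordPow u (n + 1) ++ y ∈ K * L := by
  obtain ⟨i, rfl⟩ := Nat.exists_eq_add_of_le hn
  constructor
  · rintro ⟨v, hv, w, hw, hvw⟩
    have h : v ++ w = (x ++ wordPow u k) ++ (wordPow u (l + 1 + i) ++ y) := by
      rw [show v ++ w = _ from hvw, show k + l + 1 + i = k + (l + 1 + i) by omega, wordPow_add]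
      simp only [List.append_assoc]
    rcases List.append_eq_append_iff.1 h with ⟨z, hz, rfl⟩ | ⟨z, rfl, hz⟩
    · refine ⟨v, hv, _, (hL (l + 1 + i) (by omega) z y).1 (by rwa [List.append_assoc]), ?_⟩
      change v ++ (z ++ wordPow u (l + 1 + i + 1) ++ y) = _
      rw [show k + l + 1 + i + 1 = k + (l + 1 + i + 1) by omega, wordPow_add u k,
        ← List.append_assoc, ← List.append_assoc v, ← hz]
      simp only [List.append_assoc]
    · refine ⟨_, (hK _ le_rfl x z).1 hv, w, hw, ?_⟩
      change x ++ wordPow u (k + 1) ++ z ++ w = _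
      rw [show k + l + 1 + i + 1 = (k + 1) + (l + 1 + i) by omega, wordPow_add u (k + 1),
        List.append_assoc _ z, ← hz]
      simp only [List.append_assoc]
  · rintro ⟨v, hv, w, hw, hvw⟩
    -- Here a copy of `u` is removed, so both blocks need one to spare beyond `k` and `l`; this is
    -- the reason for the `+ 1` in the bound on `n`.
    have h : v ++ w = (x ++ wordPow u (k + 1)) ++ (wordPow u (l + i + 1) ++ y) := by
      rw [show v ++ w = _ from hvw, show k + l + 1 + i + 1 = (k + 1) + (l + i + 1) by omega,
        wordPow_add u (k + 1)]
      simp only [List.append_assoc]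
    rcases List.append_eq_append_iff.1 h with ⟨z, hz, rfl⟩ | ⟨z, rfl, hz⟩
    · refine ⟨v, hv, _, (hL (l + i) (by omega) z y).2 (by rwa [List.append_assoc]), ?_⟩
      change v ++ (z ++ wordPow u (l + i) ++ y) = _
      rw [show k + l + 1 + i = (k + 1) + (l + i) by omega, wordPow_add u (k + 1),
        ← List.append_assoc, ← List.append_assoc v, ← hz]
      simp only [List.append_assoc]
    · refine ⟨_, (hK _ le_rfl x z).2 hv, w, hw, ?_⟩
      change x ++ wordPow u k ++ z ++ w = _
      rw [show k + l + 1 + i = k + (l + i + 1) by omega, wordPow_add u k,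
        List.append_assoc _ z, ← hz]
      simp only [List.append_assoc]

/-- Star-free languages over `C` are aperiodic with respect to the words of some language
in `C` that contains the empty word. -/
theorem exists_aperiodic
    (hC : ∀ L ∈ C, (Set.range (twoSidedQuotient L)).Finite ∧ ∀ p, twoSidedQuotient L p ∈ C)
    {K : Language A} (hK : K ∈ starFreeClosure C) :
    ∃ N ∈ C, [] ∈ N ∧ ∃ k, ∀ u ∈ N, ∀ n ≥ k, ∀ x y,
      x ++ wordPow u n ++ y ∈ K ↔ x ++ wordPow u (n + 1) ++ y ∈ K := by
  induction hK with
  | @base L hL =>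
    have : Finite (Set.range (twoSidedQuotient L)) := (hC L hL).1
    -- `N` consists of the words that no quotient of `L` separates from `ε`; inserting one anywhere
    -- leaves membership in `L` unchanged, so `k = 0` suffices.
    refine ⟨_, setOf_forall_mem (ι := Set.range (twoSidedQuotient L))
      (L := fun Q => {w | w ∈ Q.1 ↔ [] ∈ Q.1}) ?_, fun Q => Iff.rfl, 0, ?_⟩
    · rintro ⟨_, p, rfl⟩
      exact setOf_iff_mem ((hC L hL).2 p) _
    · intro u hu n _ x y
      have h : u ∈ twoSidedQuotient L (x, wordPow u n ++ y) ↔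
        [] ∈ twoSidedQuotient L (x, wordPow u n ++ y) := hu ⟨_, _, rfl⟩
      rw [mem_twoSidedQuotient, mem_twoSidedQuotient] at h
      rw [add_comm n 1, wordPow_add, wordPow_one]
      simpa using h.symm
  | letter a =>
    refine ⟨⊤, C.top_mem, trivial, 2, fun u _ n hn x y => ?_⟩
    rcases u.eq_nil_or_concat with rfl | hu
    · simp [wordPow]
    · have hu : 1 ≤ u.length := by
        obtain ⟨_, _, rfl⟩ := hu
        simp
      have key : ∀ m ≥ 2, x ++ wordPow u m ++ y ∉ ({[a]} : Language A) := by
        intro m hm h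
        have h' : x ++ wordPow u m ++ y = [a] := h
        have h1 := congrArg List.length h'
        simp only [List.length_append, length_wordPow, List.length_cons, List.length_nil] at h1
        nlinarith
      exact iff_of_false (key n hn) (key (n + 1) (by omega))
  | union _ _ ihK ihL =>
    obtain ⟨N, hN, hε, k, hk⟩ := ihK
    obtain ⟨N', hN', hε', k', hk'⟩ := ihL
    exact ⟨N ⊓ N', C.inf_mem hN hN', ⟨hε, hε'⟩, max k k', fun u hu n hn x y =>
      or_congr (hk u hu.1 n (le_of_max_le_left hn) x y)
        (hk' u hu.2 n (le_of_max_le_right hn) x y)⟩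
  | inter _ _ ihK ihL =>
    obtain ⟨N, hN, hε, k, hk⟩ := ihK
    obtain ⟨N', hN', hε', k', hk'⟩ := ihL
    exact ⟨N ⊓ N', C.inf_mem hN hN', ⟨hε, hε'⟩, max k k', fun u hu n hn x y =>
      and_congr (hk u hu.1 n (le_of_max_le_left hn) x y)
        (hk' u hu.2 n (le_of_max_le_right hn) x y)⟩
  | compl _ ih =>
    obtain ⟨N, hN, hε, k, hk⟩ := ih
    exact ⟨N, hN, hε, k, fun u hu n hn x y => not_congr (hk u hu n hn x y)⟩
  | concat _ _ ihK ihL =>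
    obtain ⟨N, hN, hε, k, hk⟩ := ihK
    obtain ⟨N', hN', hε', k', hk'⟩ := ihL
    exact ⟨N ⊓ N', C.inf_mem hN hN', ⟨hε, hε'⟩, k + k' + 1, fun u hu n hn x y =>
      append_wordPow_mem_mul_iff (hk u hu.1) (hk' u hu.2) hn x y⟩

theorem exists_aperiodic_hom
    (hC : ∀ L ∈ C, (Set.range (twoSidedQuotient L)).Finite ∧ ∀ p, twoSidedQuotient L p ∈ C)
    {M : Type*} [Monoid M] [Finite M] {β : FreeMonoid A →* M}
    (hβ : ∀ w, fiber β w ∈ starFreeClosure C) :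
    ∃ N ∈ C, [] ∈ N ∧ ∃ k, ∀ u ∈ N, ∀ n ≥ k,
      β (FreeMonoid.ofList u) ^ n = β (FreeMonoid.ofList u) ^ (n + 1) := by
  choose N hN hε k hk using fun w => exists_aperiodic hC (hβ w)
  choose g hg using fun m : Set.range β => m.2
  cases nonempty_fintype (Set.range β)
  refine ⟨_, setOf_forall_mem (fun m => hN (g m).toList), fun m => hε _,
    ∑ m, k (g m).toList, fun u hu n hn => ?_⟩
  let m : Set.range β := ⟨β (FreeMonoid.ofList u ^ n), _, rfl⟩
  have h := (hk (g m).toList u (hu m) n ((Finset.single_le_sum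
    (f := fun m => k (g m).toList) (fun _ _ => Nat.zero_le _) (Finset.mem_univ m)).trans hn) [] []).1
  simp only [List.nil_append, List.append_nil] at h
  have h1 : β (FreeMonoid.ofList (wordPow u n)) = β (FreeMonoid.ofList (g m).toList) := by
    rw [ofList_wordPow, FreeMonoid.ofList_toList, hg m]
  have h2 : β (FreeMonoid.ofList (wordPow u (n + 1))) = β (FreeMonoid.ofList (g m).toList) := h h1
  rw [← map_pow β, ← map_pow β, ← ofList_wordPow, ← ofList_wordPow, h1, h2]

/-! ### Ratings of fibres and the four closure conditions -/

variable [IdemSemiring R] {ρ : RatingMap A R}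

theorem RatingMap.IsMultiplicative.mul_le_fiber (hmul : ρ.IsMultiplicative) {M : Type*} [Monoid M]
    {β : FreeMonoid A →* M} {v w : List A} {q r : R} (hq : q ≤ ρ (fiber β v))
    (hr : r ≤ ρ (fiber β w)) : q * r ≤ ρ (fiber β (v ++ w)) :=
  (mul_le_mul' hq hr).trans ((hmul.2 _ _).symm.le.trans (ρ.mono (fiber_mul_le β v w)))

theorem RatingMap.IsMultiplicative.pow_le_fiber (hmul : ρ.IsMultiplicative) {M : Type*} [Monoid M]
    {β : FreeMonoid A →* M} {v : List A} {q : R} (hq : q ≤ ρ (fiber β v)) (n : ℕ) :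
    q ^ n ≤ ρ (fiber β (wordPow v n)) := by
  induction n with
  | zero =>
    rw [pow_zero, ← hmul.1]
    refine ρ.mono ?_
    rintro _ rfl
    exact rfl
  | succ n ih =>
    rw [pow_succ, wordPow_add, wordPow_one]
    exact hmul.mul_le_fiber ih hq

theorem apply_singleton_le_fiber {M : Type*} [Monoid M] (β : FreeMonoid A →* M) (w : List A) :
    ρ {w} ≤ ρ (fiber β w) :=
  ρ.mono fun v hv => by
    obtain rfl : v = w := hv
    exact rfl

variable [Finite R]

/-- Membership in `ι_C[ξ]`. -/
theorem mem_epsApprox_nested_iff [Finite A] (hquot : QuotientClosed (C : Set (Language A)))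
    (hgroup : ∀ L ∈ C, IsGroupLanguage L) {r : R} :
    r ∈ epsApprox C (nestedRatingMap (starFreeClosure C) ρ) ↔
      ∀ N ∈ C, [] ∈ N → ∀ (M : Type u) [Monoid M] [Finite M] (β : FreeMonoid A →* M),
        (∀ w, fiber β w ∈ starFreeClosure C) → ∃ w ∈ N, r ≤ ρ (fiber β w) := by
  have key : ∀ N, r ∈ optimalImprint (starFreeClosure C) N ρ ↔ _ := fun N =>
    mem_optimalImprint_iff (fun K hK => twoSidedQuotient_starFreeClosure (fun L hL =>
      ⟨(hgroup L hL).finite_range_twoSidedQuotient, hquot.twoSidedQuotient_mem hL⟩) hK)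
  constructor
  · intro h N hN hε
    exact (key N).1
      (epsApprox_le (τ := nestedRatingMap (starFreeClosure C) ρ) hN hε h)
  · intro h
    have h1 : ({r} : Set R) ≤ epsApprox C (nestedRatingMap (starFreeClosure C) ρ) :=
      le_epsApprox fun L hL hε => by
        rintro _ rfl
        exact (key L).2 (h L hL hε)
    exact h1 rfl

theorem isComplete_epsApprox_nested [Finite A] (hquot : QuotientClosed (C : Set (Language A)))
    (hgroup : ∀ L ∈ C, IsGroupLanguage L) (hmul : ρ.IsMultiplicative) :
    IsComplete C ρ (epsApprox C (nestedRatingMap (starFreeClosure C) ρ)) := by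
  have hC : ∀ L ∈ C, (Set.range (twoSidedQuotient L)).Finite ∧ ∀ p, twoSidedQuotient L p ∈ C :=
    fun L hL => ⟨(hgroup L hL).finite_range_twoSidedQuotient, hquot.twoSidedQuotient_mem hL⟩
  -- This is where group languages matter: below any `N` lies a kernel in `C`, which is closed under
  -- concatenation.
  have hker : ∀ N ∈ C, [] ∈ N → ∃ (G : Type u) (_ : Group G) (α : FreeMonoid A →* G),
      fiber α [] ∈ C ∧ fiber α [] ≤ N := by
    intro N hN hε
    obtain ⟨G, _, _, α, hα, hαN⟩ := exists_group_recognizer hquot hN (hgroup N hN)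
    exact ⟨G, _, α, hα {α (FreeMonoid.ofList [])}, fun w hw => (hαN w [] hw).2 hε⟩
  constructor
  · intro r hr q hqr
    rw [mem_epsApprox_nested_iff hquot hgroup] at hr ⊢
    intro N hN hε M _ _ β hβ
    obtain ⟨w, hw, h⟩ := hr N hN hε M β hβ
    exact ⟨w, hw, hqr.trans h⟩
  · intro q hq r hr
    rw [mem_epsApprox_nested_iff hquot hgroup] at hq hr ⊢
    intro N hN hε M _ _ β hβ
    obtain ⟨G, _, α, hα, hαN⟩ := hker N hN hε
    obtain ⟨v, hv, hqv⟩ := hq _ hα rfl M β hβ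
    obtain ⟨w, hw, hrw⟩ := hr _ hα rfl M β hβ
    exact ⟨v ++ w, hαN (fiber_mul_le α [] [] ⟨v, hv, w, hw, rfl⟩), hmul.mul_le_fiber hqv hrw⟩
  · intro r hr
    rw [mem_epsApprox_nested_iff hquot hgroup]
    intro N hN hε M _ _ β hβ
    obtain ⟨G, _, α, hα, hαN⟩ := hker N hN hε
    obtain ⟨w, hw, hrw⟩ := mem_eta.1 (epsApprox_le (τ := eta ρ _) hα rfl hr)
    -- Each factor taken from the approximation is realized by a word of the kernel of `α`;
    -- inserting these around the letters of `w` does not change its image under `α`.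
    have key : ∀ (w : List A) (r : R), r ∈ etaWord ρ (epsApprox C (nestedRatingMap (starFreeClosure C) ρ)) w →
        ∃ v ∈ fiber α w, r ≤ ρ (fiber β v) := by
      intro w
      induction w with
      | nil =>
        intro r hr
        obtain rfl : r = 1 := hr
        exact ⟨[], rfl, hmul.1 ▸ apply_singleton_le_fiber β []⟩
      | cons a w ih =>
        rintro _ ⟨_, ⟨_, ⟨s, hs, _, rfl, rfl⟩, t, ht, rfl⟩, p, hp, rfl⟩
        rw [mem_epsApprox_nested_iff hquot hgroup] at hs ht
        obtain ⟨x, hx, hsx⟩ := hs _ hα rfl M β hβ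
        obtain ⟨y, hy, hty⟩ := ht _ hα rfl M β hβ
        obtain ⟨z, hz, hpz⟩ := ih p hp
        refine ⟨x ++ [a] ++ y ++ z, ?_, hmul.mul_le_fiber (hmul.mul_le_fiber (hmul.mul_le_fiber hsx
          (apply_singleton_le_fiber β [a])) hty) hpz⟩
        exact fiber_mul_le α ([] ++ [a] ++ []) w ⟨_, fiber_mul_le α ([] ++ [a]) []
          ⟨_, fiber_mul_le α [] [a] ⟨x, hx, [a], rfl, rfl⟩, y, hy, rfl⟩, z, hz, rfl⟩
    obtain ⟨v, hv, hrv⟩ := key w r hrw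
    exact ⟨v, hαN (show α _ = α _ from (show α _ = α _ from hv).trans hw), hrv⟩
  · intro r hr
    rw [mem_epsApprox_nested_iff hquot hgroup] at hr ⊢
    intro N hN hε M _ _ β hβ
    obtain ⟨G, _, α, hα, hαN⟩ := hker N hN hε
    obtain ⟨N', hN', hε', k, hk⟩ := exists_aperiodic_hom hC hβ
    obtain ⟨u, ⟨huα, huN'⟩, hru⟩ := hr _ (C.inf_mem hα hN') ⟨rfl, hε'⟩ M β hβ
    have hω := omegaExp_pos R
    -- A multiple of `ω` keeps `rⁿ = r^ω`, and the factor `k + 1` pushes `n` past the aperiodicity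
    -- threshold.
    set n := omegaExp R * (k + 1) with hn
    have hkn : k ≤ n := by nlinarith
    have hrn : r ^ omegaExp R = r ^ n := by
      rw [hn, pow_mul, (isIdempotentElem_pow_omegaExp r).pow_succ_eq]
    refine ⟨wordPow u n, hαN ?_, ?_⟩
    · change α _ = α (FreeMonoid.ofList [])
      rw [ofList_wordPow, map_pow, show α _ = α _ from huα, FreeMonoid.ofList_nil, map_one, one_pow]
    · have hfib : fiber β (wordPow u n) = fiber β (wordPow u (n + 1)) := by
        simp only [fiber, ofList_wordPow, map_pow, hk u huN' n hkn]
        rfl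
      rw [pow_succ, hrn, ← pow_succ, add_eq_sup]
      exact sup_le (hmul.pow_le_fiber hru n) (hfib ▸ hmul.pow_le_fiber hru (n + 1))

end Soundness

/-! ## Words over a product of a group and an ordered monoid -/

section Graded

variable {G : Type u} {R : Type v} [Group G] [IdemSemiring R]

/-- The languages over `G × R` that depend only on the group component of the product of a word. -/
def gradedAlgebra (G : Type u) (R : Type v) [Group G] [IdemSemiring R] :
    BooleanSubalgebra (Language (G × R)) where
  carrier := {L | ∃ F : Set G, ∀ w : List (G × R), w ∈ L ↔ w.prod.1 ∈ F}
  supClosed' := by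
    rintro K ⟨F, hF⟩ L ⟨F', hF'⟩
    exact ⟨F ∪ F', fun w => or_congr (hF w) (hF' w)⟩
  infClosed' := by
    rintro K ⟨F, hF⟩ L ⟨F', hF'⟩
    exact ⟨F ∩ F', fun w => and_congr (hF w) (hF' w)⟩
  compl_mem' := by
    rintro K ⟨F, hF⟩
    exact ⟨Fᶜ, fun w => not_congr (hF w)⟩
  bot_mem' := ⟨∅, fun _ => Iff.rfl⟩

theorem setOf_fst_prod_mem (F : Set G) :
    ({w | w.prod.1 ∈ F} : Language (G × R)) ∈ starFreeClosure (gradedAlgebra G R) :=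
  InStarFree.base ⟨F, fun _ => Iff.rfl⟩

/-! ### Factorizations at a marked letter -/

/-- The concatenation of the words `v b` for `v` in a list of words. -/
def encode {E : Type*} (b : E) (vs : List (List E)) : List E := vs.flatMap (· ++ [b])

theorem encode_cons {E : Type*} (b : E) (v : List E) (vs : List (List E)) :
    encode b (v :: vs) = v ++ b :: encode b vs := by simp [encode]

theorem encode_append {E : Type*} (b : E) (us vs : List (List E)) :
    encode b (us ++ vs) = encode b us ++ encode b vs := by simp [encode]

theorem append_cons_inj {E : Type*} {b : E} {u v r s : List E} (hu : b ∉ u) (hv : b ∉ v)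
    (h : u ++ b :: r = v ++ b :: s) : u = v ∧ r = s := by
  induction u generalizing v with
  | nil =>
    cases v with
    | nil => simpa using h
    | cons y v =>
      simp only [List.nil_append, List.cons_append, List.cons.injEq] at h
      exact (hv (by simp [h.1])).elim
  | cons x u ih =>
    cases v with
    | nil =>
      simp only [List.nil_append, List.cons_append, List.cons.injEq] at h
      exact (hu (by simp [h.1])).elim
    | cons y v =>
      simp only [List.mem_cons, not_or] at hu hv
      simp only [List.cons_append, List.cons.injEq] at h
      obtain ⟨rfl, rfl⟩ := ih hu.2 hv.2 h.2
      exact ⟨by rw [h.1], rfl⟩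

theorem encode_inj {E : Type*} {b : E} {us vs : List (List E)} (hu : ∀ u ∈ us, b ∉ u)
    (hv : ∀ v ∈ vs, b ∉ v) (h : encode b us = encode b vs) : us = vs := by
  induction us generalizing vs with
  | nil =>
    cases vs with
    | nil => rfl
    | cons v vs => simp [encode] at h
  | cons u us ih =>
    cases vs with
    | nil => simp [encode] at h
    | cons v vs =>
      rw [encode_cons, encode_cons] at h
      obtain ⟨rfl, h'⟩ := append_cons_inj (hu u (by simp)) (hv v (by simp)) h
      rw [ih (fun x hx => hu x (List.mem_cons_of_mem _ hx))
        (fun x hx => hv x (List.mem_cons_of_mem _ hx)) h']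

theorem exists_eq_encode_append {E : Type*} {b : E} {B : Set E} (w : List E)
    (hw : ∀ x ∈ w, x ∈ insert b B) :
    ∃ vs v, (∀ v ∈ vs, ∀ x ∈ v, x ∈ B) ∧ (∀ x ∈ v, x ∈ B) ∧ w = encode b vs ++ v := by
  induction w with
  | nil => exact ⟨[], [], by simp, by simp, rfl⟩
  | cons a w ih =>
    obtain ⟨vs, v, hvs, hv, rfl⟩ := ih fun x hx => hw x (by simp [hx])
    by_cases hab : a = b
    · subst hab
      exact ⟨[] :: vs, v, by simpa using hvs, hv, by simp [encode_cons]⟩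
    · have haB : a ∈ B := (hw a (by simp)).resolve_left hab
      cases vs with
      | nil => exact ⟨[], a :: v, by simp, by simpa [haB] using hv, by simp [encode]⟩
      | cons u vs =>
        refine ⟨(a :: u) :: vs, v, ?_, hv, by simp [encode_cons]⟩
        simp only [List.mem_cons, forall_eq_or_imp] at hvs ⊢
        exact ⟨⟨haB, hvs.1⟩, hvs.2⟩

/-- The words `v₁ b ⋯ vₖ b`, with each `vᵢ` over the alphabet `B`, such that `f v₁ ⋯ f vₖ`
belongs to `L`. -/
def decodePreimage {E : Type*} (b : E) (B : Set E) (f : List E → E) (L : Language E) :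
    Language E :=
  {w | ∃ vs, (∀ v ∈ vs, ∀ x ∈ v, x ∈ B) ∧ vs.map f ∈ L ∧ w = encode b vs}

theorem fst_prod_map_eq {b : G × R} {B : Set (G × R)} {f : List (G × R) → G × R}
    (hgr : ∀ v, (∀ x ∈ v, x ∈ B) → (f v).1 = v.prod.1 * b.1) {vs : List (List (G × R))}
    (hvs : ∀ v ∈ vs, ∀ x ∈ v, x ∈ B) : (vs.map f).prod.1 = (encode b vs).prod.1 := by
  induction vs with
  | nil => rfl
  | cons v vs ih =>
    rw [encode_cons, List.map_cons, List.prod_cons, List.prod_append, List.prod_cons]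
    simp only [Prod.fst_mul]
    rw [ih fun v hv => hvs v (by simp [hv]), hgr v (hvs v (by simp)), mul_assoc]

/-- Decoding commutes with all star-free operations. As `b ∉ B`, the factorization into blocks is
unique, which intersection and complement require; `hgr` makes decoding preserve degrees, for the
base languages, and `hf` handles single letters. -/
theorem decodePreimage_mem [Finite G] [Finite R] {b : G × R} {B : Set (G × R)} (hb : b ∉ B) {f : List (G × R) → G × R}
    (hf : ∀ m, ({v | f v = m} : Language (G × R)) ∈ starFreeClosure (gradedAlgebra G R))
    (hgr : ∀ v, (∀ x ∈ v, x ∈ B) → (f v).1 = v.prod.1 * b.1) {L : Language (G × R)}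
    (hL : L ∈ starFreeClosure (gradedAlgebra G R)) :
    decodePreimage b B f L ∈ starFreeClosure (gradedAlgebra G R) := by
  have hnot : ∀ {vs : List (List (G × R))}, (∀ v ∈ vs, ∀ x ∈ v, x ∈ B) → ∀ v ∈ vs, b ∉ v :=
    fun h v hv hbv => hb (h v hv b hbv)
  have htop : decodePreimage b B f ⊤ ∈ starFreeClosure (gradedAlgebra G R) := by
    -- The encoded words are `ε` and the words over `B ∪ {b}` that end with `b`.
    refine mem_of_forall_mem_iff (BooleanSubalgebra.sup_mem nil_mem_starFreeClosure
      (mul_mem_starFreeClosure (setOf_letters_mem_starFreeClosure (insert b B))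
        (letter_mem_starFreeClosure b))) fun w => ⟨?_, ?_⟩
    · rintro ⟨vs, hvs, -, rfl⟩
      rcases vs.eq_nil_or_concat with rfl | ⟨us, u, rfl⟩
      · exact Or.inl rfl
      · refine Or.inr ⟨encode b us ++ u, ?_, [b], rfl, by simp [encode]⟩
        intro x hx
        rcases List.mem_append.1 hx with hx | hx
        · obtain ⟨v, hv, hx⟩ := List.mem_flatMap.1 hx
          rcases List.mem_append.1 hx with hx | hx
          · exact Or.inr (hvs v (by simp [hv]) x hx)
          · exact Or.inl (by simpa using hx)
        · exact Or.inr (hvs u (by simp) x hx)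
    · rintro (rfl | ⟨w, hw, _, rfl, rfl⟩)
      · exact ⟨[], by simp, trivial, rfl⟩
      · obtain ⟨vs, v, hvs, hv, rfl⟩ := exists_eq_encode_append w hw
        refine ⟨vs ++ [v], ?_, trivial, by simp [encode]⟩
        intro u hu
        rcases List.mem_append.1 hu with hu | hu
        · exact hvs u hu
        · obtain rfl : u = v := by simpa using hu
          exact hv
  induction hL with
  | base hL =>
    obtain ⟨F, hF⟩ := hL
    refine mem_of_forall_mem_iff (BooleanSubalgebra.inf_mem htop (setOf_fst_prod_mem F))
      fun w => ⟨?_, ?_⟩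
    · rintro ⟨vs, hvs, h, rfl⟩
      refine ⟨⟨vs, hvs, trivial, rfl⟩, ?_⟩
      change (encode b vs).prod.1 ∈ F
      rw [← fst_prod_map_eq hgr hvs]
      exact (hF _).1 h
    · rintro ⟨⟨vs, hvs, -, rfl⟩, h⟩
      refine ⟨vs, hvs, (hF _).2 ?_, rfl⟩
      rw [fst_prod_map_eq hgr hvs]
      exact h
  | letter m =>
    refine mem_of_forall_mem_iff (mul_mem_starFreeClosure (BooleanSubalgebra.inf_mem
      (setOf_letters_mem_starFreeClosure B) (hf m)) (letter_mem_starFreeClosure b))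
      fun w => ⟨?_, ?_⟩
    · rintro ⟨vs, hvs, h, rfl⟩
      obtain ⟨v, rfl, rfl⟩ := List.map_eq_singleton_iff.1 (show vs.map f = [m] from h)
      exact ⟨v, ⟨hvs v (by simp), rfl⟩, [b], rfl, by simp [encode]⟩
    · rintro ⟨v, ⟨hv, rfl⟩, _, rfl, rfl⟩
      exact ⟨[v], by simpa using hv, rfl, by simp [encode]⟩
  | union _ _ ihK ihL =>
    refine mem_of_forall_mem_iff (BooleanSubalgebra.sup_mem ihK ihL) fun w => ⟨?_, ?_⟩
    · rintro ⟨vs, hvs, h | h, rfl⟩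
      · exact Or.inl ⟨vs, hvs, h, rfl⟩
      · exact Or.inr ⟨vs, hvs, h, rfl⟩
    · rintro (⟨vs, hvs, h, rfl⟩ | ⟨vs, hvs, h, rfl⟩)
      · exact ⟨vs, hvs, Or.inl h, rfl⟩
      · exact ⟨vs, hvs, Or.inr h, rfl⟩
  | inter _ _ ihK ihL =>
    refine mem_of_forall_mem_iff (BooleanSubalgebra.inf_mem ihK ihL) fun w => ⟨?_, ?_⟩
    · rintro ⟨vs, hvs, ⟨h, h'⟩, rfl⟩
      exact ⟨⟨vs, hvs, h, rfl⟩, ⟨vs, hvs, h', rfl⟩⟩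
    · rintro ⟨⟨vs, hvs, h, rfl⟩, ⟨us, hus, h', e⟩⟩
      obtain rfl := encode_inj (hnot hvs) (hnot hus) e
      exact ⟨vs, hvs, ⟨h, h'⟩, rfl⟩
  | compl _ ih =>
    refine mem_of_forall_mem_iff (BooleanSubalgebra.inf_mem htop (BooleanSubalgebra.compl_mem ih))
      fun w => ⟨?_, ?_⟩
    · rintro ⟨vs, hvs, h, rfl⟩
      refine ⟨⟨vs, hvs, trivial, rfl⟩, ?_⟩
      rintro ⟨us, hus, h', e⟩
      obtain rfl := encode_inj (hnot hvs) (hnot hus) e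
      exact h h'
    · rintro ⟨⟨vs, hvs, -, rfl⟩, h⟩
      exact ⟨vs, hvs, fun h' => h ⟨vs, hvs, h', rfl⟩, rfl⟩
  | concat _ _ ihK ihL =>
    refine mem_of_forall_mem_iff (mul_mem_starFreeClosure ihK ihL) fun w => ⟨?_, ?_⟩
    · rintro ⟨vs, hvs, ⟨p, hp, q, hq, hpq⟩, rfl⟩
      obtain ⟨us, us', rfl, rfl, rfl⟩ := List.map_eq_append_iff.1 hpq.symm
      exact ⟨_, ⟨us, fun v hv => hvs v (by simp [hv]), hp, rfl⟩, _,
        ⟨us', fun v hv => hvs v (by simp [hv]), hq, rfl⟩, (encode_append b us us').symm⟩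
    · rintro ⟨_, ⟨us, hus, hp, rfl⟩, _, ⟨us', hus', hq, rfl⟩, rfl⟩
      refine ⟨us ++ us', fun v hv => (List.mem_append.1 hv).elim (hus v) (hus' v), ?_,
        (encode_append b us us').symm⟩
      rw [List.map_append]
      exact Language.append_mem_mul hp hq

/-! ### Star-free upper bounds -/

/-- There is a function with star-free fibres that bounds, by elements of `T`, the action on `X`
of each word over the alphabet `B`. -/
def HasStarFreeBound (X : Set R) (T : Submonoid (G × R)) (B : Set (G × R)) : Prop :=
  ∃ κ : List (G × R) → G × R,
    (∀ m, ({w | κ w = m} : Language (G × R)) ∈ starFreeClosure (gradedAlgebra G R)) ∧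
    (∀ w, κ w ∈ T) ∧
    ∀ w, (∀ x ∈ w, x ∈ B) → (κ w).1 = w.prod.1 ∧ ∀ x ∈ X, x * w.prod.2 ≤ x * (κ w).2

/-- The cover may overlap: `κ` reads off which `L i` contain the word and picks one of these
indices. Its fibres are unions of atoms of the algebra generated by the `L i`. -/
theorem HasStarFreeBound.of_cover {X : Set R} {T : Submonoid (G × R)} {B : Set (G × R)}
    {ι : Type*} [Finite ι] (L : ι → Language (G × R))
    (hL : ∀ i, L i ∈ starFreeClosure (gradedAlgebra G R)) (m : ι → G × R)
    (hm : ∀ i, ∀ w ∈ L i, m i ∈ T ∧ (m i).1 = w.prod.1 ∧ ∀ x ∈ X, x * w.prod.2 ≤ x * (m i).2)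
    (hcov : ∀ w, (∀ x ∈ w, x ∈ B) → ∃ i, w ∈ L i) : HasStarFreeBound X T B := by
  classical
  -- The value `1` serves words outside the cover, where only membership in `T` is required.
  let c : Set ι → G × R := fun s => if h : s.Nonempty then m h.some else 1
  have hatom : ∀ s : Set ι, ({w | {i | w ∈ L i} = s} : Language (G × R)) ∈
      starFreeClosure (gradedAlgebra G R) := fun s =>
    mem_of_forall_mem_iff (setOf_forall_mem fun i => setOf_iff_mem (hL i) (i ∈ s))
      fun w => Set.ext_iff
  have hc : ∀ w, (∃ i, w ∈ L i) → ∃ i, w ∈ L i ∧ c {i | w ∈ L i} = m i := by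
    rintro w hw
    have h : ({i | w ∈ L i} : Set ι).Nonempty := hw
    exact ⟨h.some, h.some_mem, dif_pos h⟩
  refine ⟨fun w => c {i | w ∈ L i}, fun t => preimage_mem hatom {s | c s = t}, fun w => ?_,
    fun w hw => ?_⟩
  · by_cases h : ∃ i, w ∈ L i
    · obtain ⟨i, hi, e⟩ := hc w h
      change c _ ∈ T
      rw [e]
      exact (hm i w hi).1
    · have : c {i | w ∈ L i} = 1 := dif_neg h
      change c _ ∈ T
      rw [this]
      exact T.one_mem
  · obtain ⟨i, hi, e⟩ := hc w (hcov w hw)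
    change (c _).1 = _ ∧ ∀ x ∈ X, _ ≤ x * (c _).2
    rw [e]
    exact (hm i w hi).2

/-! ### Letters acting injectively -/

/-- Each element of degree `1` of `T` has an upper bound in `T` for its two consecutive powers
from an idempotent one on. -/
def IsAperiodicallyBounded (T : Submonoid (G × R)) : Prop :=
  ∀ s : R, (1, s) ∈ T → ∃ u : R, (1, u) ∈ T ∧ ∃ n > 0, IsIdempotentElem (s ^ n) ∧
    s ^ n ≤ u ∧ s ^ (n + 1) ≤ u

/-- The power `s ^ n` also acts injectively, so it can be cancelled from `x s ^ n s ^ n = x s ^ n`.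
-/
theorem mul_pow_eq_self_of_injOn {X : Set R} {s : R} (hX : ∀ x ∈ X, x * s ∈ X)
    (hs : Set.InjOn (· * s) X) {n : ℕ} (hn : IsIdempotentElem (s ^ n)) {x : R} (hx : x ∈ X) :
    x * s ^ n = x := by
  have hstab : ∀ k, ∀ x ∈ X, x * s ^ k ∈ X := by
    intro k
    induction k with
    | zero => simp
    | succ k ih =>
      intro x hx
      rw [pow_succ', ← mul_assoc]
      exact ih _ (hX x hx)
  have hinj : ∀ k, ∀ x ∈ X, ∀ y ∈ X, x * s ^ k = y * s ^ k → x = y := by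
    intro k
    induction k with
    | zero => simp
    | succ k ih =>
      intro x hx y hy h
      rw [pow_succ', ← mul_assoc, ← mul_assoc] at h
      exact hs hx hy (ih _ (hX x hx) _ (hX y hy) h)
  refine hinj n _ (hstab n x hx) _ hx ?_
  rw [mul_assoc, hn.eq]

theorem mul_prod_mem_and_injOn {X : Set R} {T : Submonoid (G × R)} {B : Set (G × R)}
    (hXT : ∀ x ∈ X, ∀ t ∈ T, x * t.2 ∈ X) (hBT : B ⊆ T)
    (hinj : ∀ b ∈ B, Set.InjOn (· * b.2) X) (w : List (G × R)) (hw : ∀ x ∈ w, x ∈ B) :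
    w.prod ∈ T ∧ Set.InjOn (· * w.prod.2) X := by
  induction w with
  | nil => exact ⟨T.one_mem, by simp [Set.InjOn]⟩
  | cons a w ih =>
    have ha := hw a (by simp)
    obtain ⟨h1, h2⟩ := ih fun x hx => hw x (by simp [hx])
    rw [List.prod_cons]
    refine ⟨T.mul_mem (hBT ha) h1, fun x hx y hy h => ?_⟩
    simp only [Prod.snd_mul, ← mul_assoc] at h
    exact hinj a ha hx hy (h2 (hXT x hx _ (hBT ha)) (hXT y hy _ (hBT ha)) h)

/-- If all letters act as permutations, the words of a given degree have a common bound. -/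
theorem hasStarFreeBound_of_injOn [Finite G] [Finite R] {X : Set R} {T : Submonoid (G × R)} {B : Set (G × R)}
    (hXT : ∀ x ∈ X, ∀ t ∈ T, x * t.2 ∈ X) (hT : IsAperiodicallyBounded T) (hBT : B ⊆ T)
    (hinj : ∀ b ∈ B, Set.InjOn (· * b.2) X) : HasStarFreeBound X T B := by
  classical
  obtain ⟨e, heT, he⟩ : ∃ e : R, (1, e) ∈ T ∧ ∀ s : R, (1, s) ∈ T → Set.InjOn (· * s) X →
      ∀ x ∈ X, x * s ≤ x * e := by
    -- The extra claim `x ≤ x e` lets bounds be multiplied: since `sⁿ` acts as the identity, its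
    -- bound `u` satisfies both `x ≤ x u` and `x s ≤ x u`, so `e u` bounds everything `e` did, and
    -- `s` too.
    have key : ∀ S : Finset R, (∀ s ∈ S, (1, s) ∈ T ∧ Set.InjOn (· * s) X) →
        ∃ e : R, (1, e) ∈ T ∧ ∀ x ∈ X, x ≤ x * e ∧ ∀ s ∈ S, x * s ≤ x * e := by
      intro S
      induction S using Finset.induction_on with
      | empty => exact fun _ => ⟨1, T.one_mem, by simp⟩
      | insert s S _ ih =>
        intro hS
        obtain ⟨e, heT, he⟩ := ih fun t ht => hS t (Finset.mem_insert_of_mem ht)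
        obtain ⟨hsT, hsi⟩ := hS s (Finset.mem_insert_self _ _)
        obtain ⟨u, huT, n, -, hn, h1, h2⟩ := hT s hsT
        have hid : ∀ x ∈ X, x * s ^ n = x := fun x hx =>
          mul_pow_eq_self_of_injOn (fun x hx => hXT x hx _ hsT) hsi hn hx
        have hu : ∀ x ∈ X, x ≤ x * u := fun x hx =>
          (hid x hx).symm.le.trans (mul_le_mul_right h1 x)
        have hsu : ∀ x ∈ X, x * s ≤ x * u := fun x hx => by
          calc x * s = x * s ^ (n + 1) := by rw [pow_succ, ← mul_assoc, hid x hx]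
            _ ≤ x * u := mul_le_mul_right h2 x
        have heX : ∀ x ∈ X, x * e ≤ x * (e * u) := fun x hx => by
          rw [← mul_assoc]
          exact hu _ (hXT x hx _ heT)
        refine ⟨e * u, by simpa using T.mul_mem heT huT, fun x hx =>
          ⟨(he x hx).1.trans (heX x hx), fun t ht => ?_⟩⟩
        rcases Finset.mem_insert.1 ht with rfl | ht
        · refine (hsu x hx).trans ?_
          rw [← mul_assoc]
          exact mul_le_mul_left (he x hx).1 u
        · exact ((he x hx).2 t ht).trans (heX x hx)
    obtain ⟨e, heT, he⟩ := key
      (Set.toFinite {s : R | (1, s) ∈ T ∧ Set.InjOn (· * s) X}).toFinset (by simp)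
    exact ⟨e, heT, fun s hs hi x hx => (he x hx).2 s (by simpa using ⟨hs, hi⟩)⟩
  obtain ⟨N, hN, hidem⟩ := exists_pos_isIdempotentElem_pow (G × R)
  have hrep : ∀ g : G, ∃ v : List (G × R), (∀ x ∈ v, x ∈ B) ∧
      ((∃ w : List (G × R), (∀ x ∈ w, x ∈ B) ∧ w.prod.1 = g) → v.prod.1 = g) := by
    intro g
    by_cases h : ∃ w : List (G × R), (∀ x ∈ w, x ∈ B) ∧ w.prod.1 = g
    · obtain ⟨w, hw, hg⟩ := h
      exact ⟨w, hw, fun _ => hg⟩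
    · exact ⟨[], by simp, fun h' => (h h').elim⟩
  choose v hvB hv using hrep
  -- The bound depends on the degree alone: `e` times the product of a fixed word over `B` of the
  -- same degree.
  refine ⟨fun w => (1, e) * (v w.prod.1).prod,
    fun m => setOf_fst_prod_mem {g | (1, e) * (v g).prod = m},
    fun w => T.mul_mem heT (mul_prod_mem_and_injOn hXT hBT hinj _ (hvB _)).1, fun w hw => ?_⟩
  have hg := hv w.prod.1 ⟨w, hw, rfl⟩
  obtain ⟨hpT, hpi⟩ := mul_prod_mem_and_injOn hXT hBT hinj w hw
  obtain ⟨hqT, hqi⟩ := mul_prod_mem_and_injOn hXT hBT hinj _ (hvB w.prod.1)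
  set p := w.prod
  set q := (v p.1).prod
  refine ⟨by rw [Prod.fst_mul, one_mul]; exact hg, fun x hx => ?_⟩
  have hqX : ∀ x ∈ X, x * q.2 ∈ X := fun x hx => hXT x hx _ hqT
  have hq2 : IsIdempotentElem (q.2 ^ N) := by
    have := congrArg Prod.snd (hidem q).eq
    rwa [Prod.snd_mul, Prod.pow_snd] at this
  have hq1 : q.1 ^ N = 1 := by
    have := congrArg Prod.fst (hidem q).eq
    simpa using this
  -- With `N = k + 1`, the power `q ^ k` acts on `X` as an inverse of `q`. Thus `p` acts as `(p q ^
  -- k) q`, whose first factor has degree `1` and is bounded by `e`.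
  obtain ⟨k, rfl⟩ := Nat.exists_eq_succ_of_ne_zero hN.ne'
  have hsT : (1, p.2 * q.2 ^ k) ∈ T := by
    have h := T.mul_mem hpT (T.pow_mem hqT k)
    have h1 : p * q ^ k = (1, p.2 * q.2 ^ k) := by
      refine Prod.ext ?_ (by simp)
      simp only [Prod.fst_mul, Prod.pow_fst]
      rw [← hg, ← pow_succ', hq1]
    rwa [h1] at h
  have hsq : ∀ y ∈ X, y * (p.2 * q.2 ^ k) * q.2 = y * p.2 := fun y hy => by
    rw [mul_assoc, mul_assoc, ← pow_succ, ← mul_assoc]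
    exact mul_pow_eq_self_of_injOn hqX hqi hq2 (hXT y hy _ hpT)
  have hsi : Set.InjOn (· * (p.2 * q.2 ^ k)) X := by
    intro y hy z hz h
    have h' : y * (p.2 * q.2 ^ k) = z * (p.2 * q.2 ^ k) := h
    refine hpi hy hz ?_
    change y * p.2 = z * p.2
    rw [← hsq y hy, ← hsq z hz, h']
  rw [← hsq x hx]
  simp only [Prod.snd_mul, ← mul_assoc]
  have := mul_le_mul_left (he _ hsT hsi x hx) q.2
  simpa only [← mul_assoc] using this

/-! ### Factorization at a letter acting non-injectively -/

theorem mul_prod_encode_le {X : Set R} {T : Submonoid (G × R)} {B : Set (G × R)} {b : G × R}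
    {κ : List (G × R) → G × R} (hXT : ∀ x ∈ X, ∀ t ∈ T, x * t.2 ∈ X) (hb : b ∈ T)
    (hκT : ∀ w, κ w ∈ T)
    (hκ : ∀ w, (∀ x ∈ w, x ∈ B) → ∀ x ∈ X, x * w.prod.2 ≤ x * (κ w).2)
    {vs : List (List (G × R))} (hvs : ∀ v ∈ vs, ∀ x ∈ v, x ∈ B) {x : R} (hx : x ∈ X) :
    x * (encode b vs).prod.2 ≤ x * (vs.map fun v => κ v * b).prod.2 := by
  induction vs generalizing x with
  | nil => exact le_rfl
  | cons v vs ih =>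
    rw [encode_cons, List.map_cons, List.prod_cons, List.prod_append, List.prod_cons]
    simp only [Prod.snd_mul, ← mul_assoc]
    refine le_trans ?_ (ih (fun v hv => hvs v (by simp [hv]))
      (hXT _ (hXT x hx _ (hκT v)) _ hb))
    exact mul_le_mul_left (mul_le_mul_left (hκ v (hvs v (by simp)) x hx) _) _

/-- The submonoid `Tb ∪ {1}`. -/
def mulRightSubmonoid (T : Submonoid (G × R)) {b : G × R} (hb : b ∈ T) : Submonoid (G × R) where
  carrier := {t | t = 1 ∨ ∃ s ∈ T, t = s * b}
  one_mem' := Or.inl rfl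
  mul_mem' := by
    rintro _ _ (rfl | ⟨s, hs, rfl⟩) (rfl | ⟨t, ht, rfl⟩)
    · exact Or.inl (one_mul 1)
    · exact Or.inr ⟨t, ht, one_mul _⟩
    · exact Or.inr ⟨s, hs, mul_one _⟩
    · exact Or.inr ⟨s * b * t, T.mul_mem (T.mul_mem hs hb) ht, by simp only [mul_assoc]⟩

theorem mulRightSubmonoid_le {T : Submonoid (G × R)} {b : G × R} (hb : b ∈ T) :
    mulRightSubmonoid T hb ≤ T := by
  rintro _ (rfl | ⟨s, hs, rfl⟩)
  · exact T.one_mem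
  · exact T.mul_mem hs hb

/-- A bound `u` in `T` need not lie in `Tb`, but `u s ^ n` does when `s` itself comes from `Tb`; it
is still a bound because `s ^ n` is idempotent. -/
theorem IsAperiodicallyBounded.mulRightSubmonoid {T : Submonoid (G × R)}
    (hT : IsAperiodicallyBounded T) {b : G × R} (hb : b ∈ T) :
    IsAperiodicallyBounded (mulRightSubmonoid T hb) := by
  intro s hs
  rcases id hs with h1 | ⟨t, ht, hst⟩
  · obtain rfl : s = 1 := congrArg Prod.snd h1
    exact ⟨1, hs, 1, one_pos, by simp [IsIdempotentElem], by simp, by simp⟩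
  · obtain ⟨u, hu, n, hn, hid, hu1, hu2⟩ := hT s (mulRightSubmonoid_le hb hs)
    refine ⟨u * s ^ n, Or.inr ?_, n, hn, hid, ?_, ?_⟩
    · obtain ⟨k, rfl⟩ := Nat.exists_eq_succ_of_ne_zero hn.ne'
      refine ⟨(1, u) * (1, s) ^ k * t,
        T.mul_mem (T.mul_mem hu (T.pow_mem (mulRightSubmonoid_le hb hs) k)) ht, ?_⟩
      rw [mul_assoc, ← hst, mul_assoc, ← pow_succ]
      simp
    · calc s ^ n = s ^ n * s ^ n := hid.eq.symm
        _ ≤ u * s ^ n := mul_le_mul_left hu1 _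
    · calc s ^ (n + 1) = s ^ (n + 1) * s ^ n := by rw [pow_succ', mul_assoc, hid.eq]
        _ ≤ u * s ^ n := mul_le_mul_left hu2 _

/-- The case of a letter `b` that acts non-injectively: words are factorized at their
occurrences of `b`. -/
theorem HasStarFreeBound.of_insert [Finite G] [Finite R] {X : Set R} {T : Submonoid (G × R)} {B : Set (G × R)}
    {b : G × R} (hXT : ∀ x ∈ X, ∀ t ∈ T, x * t.2 ∈ X) (hb : b ∈ T) (hbB : b ∉ B)
    (h : HasStarFreeBound X T B)
    (h' : HasStarFreeBound ((· * b.2) '' X) (mulRightSubmonoid T hb) (mulRightSubmonoid T hb)) :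
    HasStarFreeBound X T (insert b B) := by
  obtain ⟨κ, hκ, hκT, hκB⟩ := h
  obtain ⟨μ, hμ, hμT, hμB⟩ := h'
  let f : List (G × R) → G × R := fun v => κ v * b
  have hf : ∀ m, ({v | f v = m} : Language (G × R)) ∈ starFreeClosure (gradedAlgebra G R) :=
    fun m => preimage_mem hκ {t | t * b = m}
  have hgr : ∀ v, (∀ x ∈ v, x ∈ B) → (f v).1 = v.prod.1 * b.1 := fun v hv => by
    rw [Prod.fst_mul, (hκB v hv).1]
  have hfT : ∀ vs : List (List (G × R)), ∀ x ∈ vs.map f, x ∈ mulRightSubmonoid T hb := by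
    intro vs x hx
    obtain ⟨v, -, rfl⟩ := List.mem_map.1 hx
    exact Or.inr ⟨κ v, hκT v, rfl⟩
  let K : G × R → Language (G × R) := fun m => {v | ∀ x ∈ v, x ∈ B} ⊓ {v | κ v = m}
  have hK : ∀ m, K m ∈ starFreeClosure (gradedAlgebra G R) := fun m =>
    BooleanSubalgebra.inf_mem (setOf_letters_mem_starFreeClosure B) (hκ m)
  -- A word either has no `b` or is `v b (v₁ b ⋯ vₖ b) v'`. The first `v b` is kept apart because
  -- `μ` only bounds the action on `Xb`.
  let L : (G × R) ⊕ (G × R) × (G × R) × (G × R) → Language (G × R) := Sum.elim K fun i =>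
    K i.1 * {[b]} * decodePreimage b B f {v | μ v = i.2.1} * K i.2.2
  let m : (G × R) ⊕ (G × R) × (G × R) × (G × R) → G × R := Sum.elim id fun i =>
    i.1 * b * i.2.1 * i.2.2
  refine of_cover L ?_ m ?_ ?_
  · rintro (t | ⟨t, t', t''⟩)
    · exact hK t
    · exact mul_mem_starFreeClosure (mul_mem_starFreeClosure (mul_mem_starFreeClosure (hK t)
        (letter_mem_starFreeClosure b)) (decodePreimage_mem hbB hf hgr (hμ t'))) (hK t'')
  · rintro (t | ⟨t, t', t''⟩) w hw
    · obtain ⟨hwB, rfl⟩ := hw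
      exact ⟨hκT w, hκB w hwB⟩
    · obtain ⟨_, ⟨_, ⟨v, ⟨hv, rfl⟩, _, rfl, rfl⟩, _, ⟨vs, hvs, rfl, rfl⟩, rfl⟩, v', ⟨hv', rfl⟩,
        rfl⟩ := hw
      change κ v * b * μ (vs.map f) * κ v' ∈ T ∧ (κ v * b * μ (vs.map f) * κ v').1 =
        (v ++ [b] ++ encode b vs ++ v').prod.1 ∧ ∀ x ∈ X,
          x * (v ++ [b] ++ encode b vs ++ v').prod.2 ≤ x * (κ v * b * μ (vs.map f) * κ v').2
      have hμ' := mulRightSubmonoid_le hb (hμT (vs.map f))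
      obtain ⟨hμ1, hμ2⟩ := hμB _ (hfT vs)
      simp only [List.prod_append, List.prod_singleton]
      refine ⟨T.mul_mem (T.mul_mem (T.mul_mem (hκT v) hb) hμ') (hκT v'), ?_, fun x hx => ?_⟩
      · simp only [Prod.fst_mul]
        rw [(hκB v hv).1, (hκB v' hv').1, hμ1, fst_prod_map_eq hgr hvs]
      · simp only [Prod.snd_mul, ← mul_assoc]
        have hx1 := hXT x hx _ (hκT v)
        have hx2 := hXT _ hx1 _ hb
        have hx3 := hXT _ hx2 _ hμ'
        calc x * v.prod.2 * b.2 * (encode b vs).prod.2 * v'.prod.2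
            ≤ x * (κ v).2 * b.2 * (encode b vs).prod.2 * v'.prod.2 :=
              mul_le_mul_left (mul_le_mul_left (mul_le_mul_left ((hκB v hv).2 x hx) _) _) _
          _ ≤ x * (κ v).2 * b.2 * (vs.map f).prod.2 * v'.prod.2 :=
              mul_le_mul_left (mul_prod_encode_le hXT hb hκT (fun w hw => (hκB w hw).2) hvs hx2) _
          _ ≤ x * (κ v).2 * b.2 * (μ (vs.map f)).2 * v'.prod.2 :=
              mul_le_mul_left (hμ2 _ ⟨_, hx1, rfl⟩) _
          _ ≤ x * (κ v).2 * b.2 * (μ (vs.map f)).2 * (κ v').2 := (hκB v' hv').2 _ hx3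
  · intro w hw
    obtain ⟨vs, v', hvs, hv', rfl⟩ := exists_eq_encode_append w hw
    cases vs with
    | nil => exact ⟨Sum.inl (κ v'), hv', rfl⟩
    | cons v vs =>
      refine ⟨Sum.inr (κ v, μ (vs.map f), κ v'), _, ⟨_, ⟨v, ⟨hvs v (by simp), rfl⟩, [b], rfl, rfl⟩,
        _, ⟨vs, fun v hv => hvs v (by simp [hv]), rfl, rfl⟩, rfl⟩, v', ⟨hv', rfl⟩, ?_⟩
      simp [encode_cons]

/-- Cutting at `b` shrinks the alphabet for the blocks and shrinks `X` to `Xb` for the sequence of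
blocks. The second call may use a larger alphabet, so `X` is the outer induction parameter. `Tb ∪
{1}` replaces `T` there because it maps `Xb` into itself. -/
theorem hasStarFreeBound [Finite G] [Finite R] (X : Set R) (T : Submonoid (G × R)) (B : Set (G × R))
    (hXT : ∀ x ∈ X, ∀ t ∈ T, x * t.2 ∈ X) (hT : IsAperiodicallyBounded T) (hBT : B ⊆ T) :
    HasStarFreeBound X T B := by
  induction hn : X.ncard using Nat.strong_induction_on generalizing X T B with
  | _ n ihX =>
    induction hk : B.ncard using Nat.strong_induction_on generalizing B with
    | _ k ihB =>
      by_cases hinj : ∀ b ∈ B, Set.InjOn (· * b.2) X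
      · exact hasStarFreeBound_of_injOn hXT hT hBT hinj
      · push Not at hinj
        obtain ⟨b, hbB, hb⟩ := hinj
        have hbT := hBT hbB
        rw [← Set.insert_sdiff_self_of_mem hbB]
        refine HasStarFreeBound.of_insert hXT hbT (by simp) (ihB _ ?_ (B \ {b})
          (Set.sdiff_subset.trans hBT) rfl) (ihX _ ?_ _ _ _ ?_ (hT.mulRightSubmonoid hbT)
          subset_rfl rfl)
        · rw [← hk]
          exact Set.ncard_sdiff_singleton_lt_of_mem hbB
        · rw [← hn]
          exact lt_of_le_of_ne (Set.ncard_image_le X.toFinite) fun h =>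
            hb ((Set.ncard_image_iff X.toFinite).1 h)
        · rintro _ ⟨x, hx, rfl⟩ _ (rfl | ⟨s, hs, rfl⟩)
          · exact ⟨x, hx, by simp⟩
          · exact ⟨x * b.2 * s.2, hXT _ (hXT x hx _ hbT) _ hs, by simp [mul_assoc]⟩

end Graded

/-! ## The optimal approximation is the least complete set -/

section Minimality

variable {A : Type u} {R : Type v} [IdemSemiring R]

/-- The set `S · {ρ(a₁)} · S ⋯ S · {ρ(aₙ)} · S`. -/
def paddedWord (ρ : RatingMap A R) (S : Set R) (w : List A) : Set R :=
  w.foldr (fun a E => S * {ρ {[a]}} * E) S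

theorem paddedWord_cons (ρ : RatingMap A R) (S : Set R) (a : A) (w : List A) :
    paddedWord ρ S (a :: w) = S * {ρ {[a]}} * paddedWord ρ S w := rfl

variable {ρ : RatingMap A R} {S : Set R}

theorem mul_paddedWord_subset (hS : S * S ⊆ S) (w : List A) :
    S * paddedWord ρ S w ⊆ paddedWord ρ S w := by
  cases w with
  | nil => exact hS
  | cons a w =>
    rw [paddedWord_cons, ← mul_assoc, ← mul_assoc]
    exact Set.mul_subset_mul_right (Set.mul_subset_mul_right hS)

theorem paddedWord_mul_paddedWord_subset (hS : S * S ⊆ S) (v w : List A) :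
    paddedWord ρ S v * paddedWord ρ S w ⊆ paddedWord ρ S (v ++ w) := by
  induction v with
  | nil => exact mul_paddedWord_subset hS w
  | cons a v ih =>
    rw [List.cons_append, paddedWord_cons, paddedWord_cons, mul_assoc]
    exact Set.mul_subset_mul_left ih

/-- Between two letters `etaWord` has two factors `S` where `paddedWord` has one; the missing one is
supplied by `1 ∈ S`. -/
theorem paddedWord_subset (h1 : (1 : R) ∈ S) (w : List A) :
    paddedWord ρ S w ⊆ S * etaWord ρ S w := by
  induction w with
  | nil => simp [paddedWord, etaWord]
  | cons a w ih =>
    have h : etaWord ρ S (a :: w) = S * {ρ {[a]}} * S * etaWord ρ S w := rfl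
    rw [paddedWord_cons, h, mul_assoc _ S]
    intro r hr
    exact ⟨1, h1, r, Set.mul_subset_mul_left ih hr, one_mul r⟩

theorem RatingMap.IsNice.le_of_forall [Finite R] (hnice : ρ.IsNice) {K : Language A} {r : R}
    (h : ∀ w ∈ K, ρ {w} ≤ r) : ρ K ≤ r := by
  by_cases hK : ∃ w, w ∈ K
  · obtain ⟨F, hF, e⟩ := hnice K hK
    rw [e]
    exact Finset.sup_le fun w hw => h w (hF w hw)
  · obtain rfl : K = ⊥ := Set.eq_empty_of_forall_notMem fun w hw => hK ⟨w, hw⟩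
    rw [map_bot]
    exact bot_le

theorem RatingMap.IsMultiplicative.apply_singleton (hmul : ρ.IsMultiplicative) (w : List A) :
    ρ {w} = (w.map fun a => ρ {[a]}).prod := by
  induction w with
  | nil => exact hmul.1
  | cons a w ih =>
    rw [List.map_cons, List.prod_cons, ← ih, ← hmul.2]
    congr 1
    refine Set.ext fun v => ⟨?_, ?_⟩
    · rintro rfl
      exact ⟨[a], rfl, w, rfl, rfl⟩
    · rintro ⟨_, rfl, _, rfl, rfl⟩
      exact rfl

/-- Preimages of star-free languages under letter-to-letter morphisms. -/
theorem map_preimage_mem_starFreeClosure [Finite A] {B : Type*}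
    {C : BooleanSubalgebra (Language A)} {C' : BooleanSubalgebra (Language B)} (f : A → B)
    (hf : ∀ L ∈ C', ({w | w.map f ∈ L} : Language A) ∈ C) {L : Language B}
    (hL : L ∈ starFreeClosure C') : ({w | w.map f ∈ L} : Language A) ∈ starFreeClosure C := by
  induction hL with
  | base hL => exact InStarFree.base (hf _ hL)
  | letter b =>
    refine mem_of_forall_mem_iff (setOf_exists_mem (ι := {a // f a = b})
      fun a => letter_mem_starFreeClosure a.1) fun w => ⟨fun hw => ?_, ?_⟩
    · obtain ⟨a, rfl, h⟩ := List.map_eq_singleton_iff.1 (show w.map f = [b] from hw)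
      exact ⟨⟨a, h⟩, rfl⟩
    · rintro ⟨⟨a, rfl⟩, rfl⟩
      exact rfl
  | union _ _ ihK ihL => exact InStarFree.union ihK ihL
  | inter _ _ ihK ihL => exact InStarFree.inter ihK ihL
  | compl _ ih => exact InStarFree.compl ih
  | concat _ _ ihK ihL =>
    refine mem_of_forall_mem_iff (mul_mem_starFreeClosure ihK ihL) fun w => ⟨?_, ?_⟩
    · rintro ⟨p, hp, q, hq, hpq⟩
      obtain ⟨x, y, rfl, rfl, rfl⟩ := List.map_eq_append_iff.1 hpq.symm
      exact ⟨x, hp, y, hq, rfl⟩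
    · rintro ⟨x, hp, y, hq, rfl⟩
      refine ⟨_, hp, _, hq, ?_⟩
      simp

variable [Finite A] [Finite R] {C : BooleanSubalgebra (Language A)}

theorem epsApprox_nested_subset (hquot : QuotientClosed (C : Set (Language A)))
    (hgroup : ∀ L ∈ C, IsGroupLanguage L) (hnice : ρ.IsNice) (hmul : ρ.IsMultiplicative)
    (hS : IsComplete C ρ S) :
    epsApprox C (nestedRatingMap (starFreeClosure C) ρ) ⊆ S := by
  classical
  obtain ⟨L, hL⟩ := exists_isOptimalEpsApprox C (eta ρ S)
  have hLS : ∀ w ∈ L, etaWord ρ S w ⊆ S := fun w hw r hr =>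
    hS.operation (by rw [epsApprox_eq hL]; exact ⟨w, hw, hr⟩)
  have h1S : (1 : R) ∈ S := hLS [] hL.2.1 rfl
  have hSS : S * S ⊆ S := by
    rintro _ ⟨q, hq, r, hr, rfl⟩
    exact hS.mul q hq r hr
  obtain ⟨G, _, _, α, hα, hαL⟩ := exists_group_recognizer hquot hL.1 (hgroup L hL.1)
  let T : Submonoid (G × R) :=
    { carrier := {t | ∃ w : List A, α (FreeMonoid.ofList w) = t.1 ∧ t.2 ∈ paddedWord ρ S w}
      one_mem' := ⟨[], map_one α, h1S⟩
      mul_mem' := by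
        rintro s t ⟨v, hv, hs⟩ ⟨w, hw, ht⟩
        refine ⟨v ++ w, ?_, paddedWord_mul_paddedWord_subset hSS v w (Set.mul_mem_mul hs ht)⟩
        rw [FreeMonoid.ofList_append, map_mul, hv, hw, Prod.fst_mul] }
  -- A word in the kernel of `α` lies in `L`, where `η_{ρ,S}` takes values inside `S` by
  -- `hS.operation`; conversely the empty word already contributes all of `S`.
  have hT1 : ∀ s, (1, s) ∈ T ↔ s ∈ S := by
    intro s
    constructor
    · rintro ⟨w, hw, hs⟩
      have hwL : w ∈ L := (hαL w [] (hw.trans (map_one α).symm)).2 hL.2.1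
      obtain ⟨q, hq, r, hr, rfl⟩ := paddedWord_subset h1S w hs
      exact hS.mul q hq r (hLS w hwL hr)
    · intro hs
      exact ⟨[], map_one α, hs⟩
  have hT : IsAperiodicallyBounded T := by
    intro s hs
    have hs' := hS.closure s ((hT1 s).1 hs)
    refine ⟨_, (hT1 _).2 hs', omegaExp R, omegaExp_pos R, isIdempotentElem_pow_omegaExp s, ?_, ?_⟩
    · rw [add_eq_sup]
      exact le_sup_left
    · rw [add_eq_sup]
      exact le_sup_right
  let f : A → G × R := fun a => (α (FreeMonoid.of a), ρ {[a]})
  have hfT : Set.range f ⊆ T := by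
    rintro _ ⟨a, rfl⟩
    refine ⟨[a], rfl, ?_⟩
    exact ⟨_, ⟨1, h1S, _, rfl, rfl⟩, 1, h1S, by simp [f]⟩
  have hf : ∀ w : List A, (w.map f).prod = (α (FreeMonoid.ofList w), ρ {w}) := by
    intro w
    rw [hmul.apply_singleton]
    induction w with
    | nil => exact Prod.ext (map_one α).symm rfl
    | cons a w ih =>
      rw [List.map_cons, List.prod_cons, ih, FreeMonoid.ofList_cons, map_mul]
      rfl
  -- With `X` the whole of `R`, the bound at `x = 1` gives `ρ(w) ≤ (κ (w.map f)).2`.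
  obtain ⟨κ, hκ, hκT, hκB⟩ := hasStarFreeBound Set.univ T (Set.range f)
    (fun _ _ _ _ => Set.mem_univ _) hT hfT
  have hbound : ∀ w : List A, (κ (w.map f)).1 = α (FreeMonoid.ofList w) ∧
      ρ {w} ≤ (κ (w.map f)).2 := by
    intro w
    obtain ⟨h1, h2⟩ := hκB (w.map f) (by simp)
    have h3 := h2 1 trivial
    rw [hf] at h1 h3
    exact ⟨h1, by simpa using h3⟩
  cases nonempty_fintype R
  let K : R → Language A := fun s => {w | w.map f ∈ ({v | κ v = (1, s)} : Language (G × R))}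
  have hK : ∀ s, K s ∈ starFreeClosure C := fun s => by
    refine map_preimage_mem_starFreeClosure f ?_ (hκ (1, s))
    rintro L ⟨F, hF⟩
    refine mem_of_forall_mem_iff (hα F) fun w => (hF _).trans ?_
    rw [hf]
    rfl
  have hcov : IsCover (starFreeClosure C) {w | α (FreeMonoid.ofList w) ∈ ({1} : Set G)}
      (Finset.univ.image K) := by
    constructor
    · intro L hL
      obtain ⟨s, -, rfl⟩ := Finset.mem_image.1 hL
      exact hK s
    · intro w hw
      refine ⟨K (κ (w.map f)).2, Finset.mem_image_of_mem _ (Finset.mem_univ _), ?_⟩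
      exact Prod.ext ((hbound w).1.trans hw) rfl
  refine (epsApprox_le (τ := nestedRatingMap (starFreeClosure C) ρ) (hα {1})
    (map_one α)).trans ((optimalImprint_subset hcov).trans ?_)
  rintro r ⟨_, hs, hr⟩
  obtain ⟨s, -, rfl⟩ := Finset.mem_image.1 hs
  -- The index `s` runs over all of `R`; only a word in `K s` certifies `s ∈ S`. An empty `K s`
  -- contributes just `⊥`, which lies below `1 ∈ S`.
  by_cases hne : ∃ w, w ∈ K s
  · obtain ⟨w, hw⟩ := hne
    have hsS : s ∈ S := (hT1 s).1 ((show κ (w.map f) = (1, s) from hw) ▸ hκT _)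
    refine hS.downset s hsS r (hr.trans (hnice.le_of_forall fun v hv => ?_))
    have h := (hbound v).2
    rwa [show κ (v.map f) = (1, s) from hv] at h
  · have : K s = ⊥ := Set.eq_empty_of_forall_notMem fun w hw => hne ⟨w, hw⟩
    rw [this, map_bot] at hr
    exact hS.downset 1 h1S r (hr.trans bot_le)

end Minimality

end StarFreeClosure

theorem mainTheorem5 {A : Type*} [Finite A] (C : BooleanSubalgebra (Language A))
    (hquot : StarFreeClosure.QuotientClosed (C : Set (Language A)))
    (hgroup : ∀ L ∈ C, StarFreeClosure.IsGroupLanguage L)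
    {R : Type*} [IdemSemiring R] [Finite R] (ρ : StarFreeClosure.RatingMap A R)
    (hnice : StarFreeClosure.RatingMap.IsNice ρ)
    (hmul : StarFreeClosure.RatingMap.IsMultiplicative ρ) :
    IsLeast {S : Set R | StarFreeClosure.IsComplete C ρ S}
      (StarFreeClosure.epsApprox C
        (StarFreeClosure.nestedRatingMap (StarFreeClosure.starFreeClosure C) ρ)) :=
  ⟨StarFreeClosure.isComplete_epsApprox_nested hquot hgroup hmul, fun _ hS =>
    StarFreeClosure.epsApprox_nested_subset hquot hgroup hnice hmul hS⟩
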